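/- **Theorem 2.3 (Renormalization in Case 2).** Let $(X,\Sigma,\mu)$ be a $\sigma$-finite measure space, let $D,N\in\mathbb{N}_0$, let $\mathcal{F}=\bigoplus_{n\ge 0}S_nL^2(X)^{\otimes n}$ be the bosonic Fock space over $L^2(X)$ with vacuum $\Omega$, let $\mathfrak{H}=\mathbb{C}^D\otimes\mathcal{F}$, and write $\Psi^{(n)}$ for the $n$-boson component of $\Psi$. For $h\in L^2(X)$ let $a^*(h)$ and $a(h)$ be the creation and annihilation operators, $a^*(h)\psi=\sqrt{n+1}\,S_{n+1}(h\otimes\psi)$ on the $n$-boson sector and $a(h)$ its adjoint sector by sector, both on the domain $\operatorname{Dom}(\mathcal{N}^{1/2})=\{\Psi\in\mathfrak{H}:\sum_n n\Vert\Psi^{(n)}\Vert^2<\infty\}$. A matrix $M\in\mathbb{C}^{D\times D}$ acts on $\mathfrak{H}$ as $M\otimes 1$. Let $K=K^*\in\mathbb{C}^{D\times D}$, and let $B_1,\dots,B_N\in\mathbb{C}^{D\times D}$ satisfy $[B_j,B_{j'}]=0$ for all $j,j'$. Let $\omega:X\to\mathbb{R}$ be measurable with $\omega\ge m$ almost everywhere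 for some constant $m>0$, and let $f_1,\dots,f_N:X\to\mathbb{C}$ be measurable with $\omega^{-1}f_j\in L^2(X)$ for all $j$. Let $(e_\ell)_{\ell\in I}$ be an orthonormal basis of $L^2(X)$ contained in the domain $\operatorname{Dom}(\omega)=\{\phi\in L^2(X):\omega\phi\in L^2(X)\}$ of the multiplication operator $\omega$ (typically $I=\mathbb{N}$), and put $a^*_\ell=a^*(e_\ell)$ and $$\hat a_\ell=a(e_\ell)+\sum_{j=1}^N\Big\langle e_\ell,\frac{f_j}{\omega}\Big\rangle B_j .$$ Let $T=\exp(G)=\sum_{n\ge0}G^n/n!$ with $G=-\sum_{j=1}^NB_j\,a^*(f_j/\omega)$, where $(T\Psi)^{(m)}$ is the finite sum $\sum_{n\le m}\frac1{n!}(G^n\Psi)^{(m)}$ and $\operatorname{Dom}(T)=\{\Psi\in\mathfrak{H}:\sum_m\Vert(T\Psi)^{(m)}\Vert^2<\infty\}$. Then the following hold. 1. For all $v\in\mathbb{C}^D$, $n\in\mathbb{N}_0$ and $\ell_1,\dots,\ell_n\in I$, the dressed test vector $a^*_{\ell_1}\cdots a^*_{\ell_n}T(v\otimes\Omega)\in\mathfrak{H}$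 is well defined: $v\otimes\Omega\in\operatorname{Dom}(T)$, and each creation operator is applied to a vector of its domain. 2. The linear span $\mathcal{D}$ of all dressed test vectors is dense in $\mathfrak{H}$. 3. The linear operator $H:\mathcal{D}\to\mathfrak{H}$, $$H\Psi=\sum_{\ell,\ell'\in I}\langle e_\ell,\omega e_{\ell'}\rangle\,\hat a_\ell^*\hat a_{\ell'}\Psi+K\Psi ,$$ is well defined: for $\Psi\in\mathcal{D}$ every $\hat a_\ell^*\hat a_{\ell'}\Psi$ is defined, where $\hat a_\ell^*$ is the adjoint of $\hat a_\ell$, and the double series converges unconditionally in $\mathfrak{H}$. 4. $H$ is symmetric and bounded below: there is $c\in\mathbb{R}$ with $\langle\Psi,H\Psi\rangle\ge c\Vert\Psi\Vert^2$ for all $\Psi\in\mathcal{D}$. 5. The Friedrichs extension of $H$, that is, the restriction of the adjoint of $H$ to those vectors of its domain that lie in the domain of the closure of the quadratic form $\Psi\mapsto\langle\Psi,H\Psi\rangle$, is a self-adjoint extension of $H$ with the same lower bound $c$. -/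

import Mathlib

open MeasureTheory Filter Topology
open scoped ENNReal InnerProductSpace LinearPMap

noncomputable section

namespace GSB

section Sectors

variable {X : Type*} [MeasurableSpace X] (μ : Measure X) [SigmaFinite μ] (D : ℕ)

/-- `ℂ^D ⊗ L²(X)^{⊗ n}`, realised as the space of square integrable functions `X^n → ℂ^D`. -/
abbrev NBody (n : ℕ) : Type _ :=
  Lp (EuclideanSpace ℂ (Fin D)) 2 (Measure.pi (fun _ : Fin n => μ))

theorem measurePreserving_perm {n : ℕ} (σ : Equiv.Perm (Fin n)) :
    MeasurePreserving (fun k : Fin n → X => k ∘ σ)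
      (Measure.pi (fun _ : Fin n => μ)) (Measure.pi (fun _ : Fin n => μ)) := by
  have h := measurePreserving_piCongrLeft (fun _ : Fin n => μ) σ.symm
  convert h using 1
  funext k i
  have := Equiv.piCongrLeft_apply_apply (fun _ : Fin n => X) σ.symm k (σ i)
  rw [Equiv.symm_apply_apply] at this
  exact this.symm

/-- Permutation of the particles: `(U_σ ψ)(k) = ψ(k ∘ σ)`. -/
def permute {n : ℕ} (σ : Equiv.Perm (Fin n)) : NBody μ D n →ₗᵢ[ℂ] NBody μ D n :=
  Lp.compMeasurePreservingₗᵢ ℂ (fun k : Fin n → X => k ∘ σ) (measurePreserving_perm μ σ)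

theorem permute_permute {n : ℕ} (σ τ : Equiv.Perm (Fin n)) (ψ : NBody μ D n) :
    permute μ D σ (permute μ D τ ψ) = permute μ D (σ * τ) ψ :=
  (Lp.compMeasurePreserving_comp_apply ψ (measurePreserving_perm μ τ)
    (measurePreserving_perm μ σ)).symm

/-- The subspace of functions that are invariant under all permutations of the particles. -/
def symSubmodule (n : ℕ) : Submodule ℂ (NBody μ D n) where
  carrier := {ψ | ∀ σ : Equiv.Perm (Fin n), permute μ D σ ψ = ψ}
  zero_mem' σ := map_zero _
  add_mem' hψ hφ σ := by rw [map_add, hψ σ, hφ σ]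
  smul_mem' c ψ hψ σ := by rw [map_smul, hψ σ]

theorem isClosed_symSubmodule (n : ℕ) : IsClosed (symSubmodule μ D n : Set (NBody μ D n)) := by
  have : (symSubmodule μ D n : Set (NBody μ D n)) =
      ⋂ σ : Equiv.Perm (Fin n), {ψ | permute μ D σ ψ = ψ} := by
    ext ψ
    simp [symSubmodule]
  rw [this]
  exact isClosed_iInter fun σ => isClosed_eq (permute μ D σ).continuous continuous_id

/-- The `n`-boson sector `ℂ^D ⊗ S_n L²(X)^{⊗ n}`. -/
abbrev Sector (n : ℕ) : Type _ := symSubmodule μ D n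

instance (n : ℕ) : CompleteSpace (Sector μ D n) :=
  (isClosed_symSubmodule μ D n).completeSpace_coe

/-- The average over all permutations of the particles. -/
def average (n : ℕ) : NBody μ D n →L[ℂ] NBody μ D n :=
  ((n.factorial : ℂ)⁻¹) •
    ∑ σ : Equiv.Perm (Fin n), (permute μ D σ).toContinuousLinearMap

theorem average_mem (n : ℕ) (ψ : NBody μ D n) : average μ D n ψ ∈ symSubmodule μ D n := by
  intro τ
  simp only [average, smul_apply, sum_apply,
    LinearIsometry.coe_toContinuousLinearMap, map_smul, map_sum, permute_permute]
  congr 1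
  exact Fintype.sum_equiv (Equiv.mulLeft τ) _ _ fun σ => rfl

theorem norm_average_le (n : ℕ) (ψ : NBody μ D n) : ‖average μ D n ψ‖ ≤ ‖ψ‖ := by
  have hn : (0 : ℝ) < n.factorial := by exact_mod_cast n.factorial_pos
  simp only [average, smul_apply, sum_apply,
    LinearIsometry.coe_toContinuousLinearMap]
  rw [norm_smul, norm_inv, Complex.norm_natCast, inv_mul_le_iff₀ hn]
  refine (norm_sum_le _ _).trans ?_
  simp [Fintype.card_perm]

/-- The symmetrization operator `S_n`, with values in the `n`-boson sector. -/
def symmetrize (n : ℕ) : NBody μ D n →L[ℂ] Sector μ D n :=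
  (average μ D n).codRestrict (symSubmodule μ D n) (average_mem μ D n)

variable {μ D}

theorem memLp_tensor (f : Lp ℂ 2 μ) {n : ℕ} (ψ : NBody μ D n) :
    MemLp (fun k : Fin (n + 1) → X => f (k 0) • ψ (Fin.tail k)) 2
      (Measure.pi (fun _ : Fin (n + 1) => μ)) := by
  have h : MemLp (fun p : X × (Fin n → X) => f p.1 • ψ p.2) 2
      (μ.prod (Measure.pi (fun _ : Fin n => μ))) := by
    have hm : AEStronglyMeasurable (fun p : X × (Fin n → X) => f p.1 • ψ p.2)
        (μ.prod (Measure.pi (fun _ : Fin n => μ))) :=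
      (Lp.aestronglyMeasurable f).comp_fst.smul (Lp.aestronglyMeasurable ψ).comp_snd
    rw [memLp_two_iff_integrable_sq_norm hm]
    simp only [norm_smul, mul_pow]
    exact ((memLp_two_iff_integrable_sq_norm (Lp.aestronglyMeasurable f)).1 (Lp.memLp f)).mul_prod
      ((memLp_two_iff_integrable_sq_norm (Lp.aestronglyMeasurable ψ)).1 (Lp.memLp ψ))
  exact h.comp_measurePreserving (measurePreserving_piFinSuccAbove (fun _ : Fin (n + 1) => μ) 0)

/-- The tensor product `f ⊗ ψ`, that is `(f ⊗ ψ)(k₀, …, kₙ) = f(k₀) ψ(k₁, …, kₙ)`. -/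
def tensor (f : Lp ℂ 2 μ) {n : ℕ} (ψ : NBody μ D n) : NBody μ D (n + 1) :=
  (memLp_tensor f ψ).toLp _

theorem ae_tail {n : ℕ} {p : (Fin n → X) → Prop}
    (h : ∀ᵐ k ∂(Measure.pi (fun _ : Fin n => μ)), p k) :
    ∀ᵐ k ∂(Measure.pi (fun _ : Fin (n + 1) => μ)), p (Fin.tail k) := by
  have h1 := (measurePreserving_piFinSuccAbove
    (fun _ : Fin (n + 1) => μ) 0).quasiMeasurePreserving
  exact (Measure.quasiMeasurePreserving_snd.comp h1).ae h

theorem norm_sq_L2 {α : Type*} [MeasurableSpace α] {ν : Measure α} {G : Type*}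
    [NormedAddCommGroup G] [InnerProductSpace ℂ G] (φ : Lp G 2 ν) :
    ‖φ‖ ^ 2 = ∫ x, ‖φ x‖ ^ 2 ∂ν := by
  rw [← inner_self_eq_norm_sq (𝕜 := ℂ) φ, L2.inner_def, ← integral_re (L2.integrable_inner φ φ)]
  exact integral_congr_ae (Eventually.of_forall fun x => inner_self_eq_norm_sq (𝕜 := ℂ) (φ x))

theorem norm_tensor (f : Lp ℂ 2 μ) {n : ℕ} (ψ : NBody μ D n) :
    ‖tensor f ψ‖ = ‖f‖ * ‖ψ‖ := by
  have h : ‖tensor f ψ‖ ^ 2 = (‖f‖ * ‖ψ‖) ^ 2 := by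
    rw [mul_pow, norm_sq_L2, norm_sq_L2, norm_sq_L2, ← integral_prod_mul]
    rw [← (measurePreserving_piFinSuccAbove (fun _ : Fin (n + 1) => μ) 0).integral_comp']
    refine integral_congr_ae ?_
    filter_upwards [(memLp_tensor f ψ).coeFn_toLp] with k hk
    rw [tensor, hk, norm_smul, mul_pow]
    rfl
  exact (pow_left_inj₀ (norm_nonneg _) (by positivity) two_ne_zero).1 h

variable (D) in
/-- The operator `ψ ↦ f ⊗ ψ`. -/
def tensorL (f : Lp ℂ 2 μ) (n : ℕ) : NBody μ D n →L[ℂ] NBody μ D (n + 1) :=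
  LinearMap.mkContinuous
    { toFun := tensor f
      map_add' := fun ψ φ => by
        refine Lp.ext ?_
        filter_upwards [(memLp_tensor f (ψ + φ)).coeFn_toLp, (memLp_tensor f ψ).coeFn_toLp,
          (memLp_tensor f φ).coeFn_toLp, ae_tail (Lp.coeFn_add ψ φ),
          Lp.coeFn_add (tensor f ψ) (tensor f φ)] with k h1 h2 h3 h4 h5
        rw [h5, Pi.add_apply]
        simp only [tensor]
        rw [h1, h2, h3, h4, Pi.add_apply, smul_add]
      map_smul' := fun c ψ => by
        refine Lp.ext ?_
        filter_upwards [(memLp_tensor f (c • ψ)).coeFn_toLp, (memLp_tensor f ψ).coeFn_toLp,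
          ae_tail (Lp.coeFn_smul c ψ), Lp.coeFn_smul c (tensor f ψ)] with k h1 h2 h3 h4
        rw [RingHom.id_apply, h4, Pi.smul_apply]
        simp only [tensor]
        rw [h1, h2, h3, Pi.smul_apply, smul_comm] }
    ‖f‖ fun ψ => (norm_tensor f ψ).le

variable (D) in
/-- The creation operator between sectors: `a*(f) ψ = √(n+1) S_{n+1} (f ⊗ ψ)`. -/
def createSector (f : Lp ℂ 2 μ) (n : ℕ) : Sector μ D n →L[ℂ] Sector μ D (n + 1) :=
  ((Real.sqrt (n + 1) : ℝ) : ℂ) •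
    (symmetrize μ D (n + 1) ∘L tensorL D f n ∘L (symSubmodule μ D n).subtypeL)

variable (D) in
/-- The annihilation operator between sectors, the adjoint of the creation operator. -/
def annihilateSector (f : Lp ℂ 2 μ) (n : ℕ) : Sector μ D (n + 1) →L[ℂ] Sector μ D n :=
  ContinuousLinearMap.adjoint (createSector D f n)

theorem norm_createSector_le (f : Lp ℂ 2 μ) (n : ℕ) :
    ‖createSector D f n‖ ≤ Real.sqrt (n + 1) * ‖f‖ := by
  refine ContinuousLinearMap.opNorm_le_bound _ (by positivity) fun ψ => ?_
  have h1 : ‖symmetrize μ D (n + 1) (tensorL D f n (ψ : NBody μ D n))‖ ≤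
      ‖tensorL D f n (ψ : NBody μ D n)‖ := norm_average_le μ D (n + 1) _
  have h2 : ‖tensorL D f n (ψ : NBody μ D n)‖ = ‖f‖ * ‖ψ‖ := norm_tensor f _
  change ‖((Real.sqrt (n + 1) : ℝ) : ℂ) •
    symmetrize μ D (n + 1) (tensorL D f n (ψ : NBody μ D n))‖ ≤ _
  rw [norm_smul, Complex.norm_real, Real.norm_of_nonneg (Real.sqrt_nonneg _), mul_assoc]
  gcongr
  exact h1.trans h2.le

theorem norm_annihilateSector_le (f : Lp ℂ 2 μ) (n : ℕ) :
    ‖annihilateSector D f n‖ ≤ Real.sqrt (n + 1) * ‖f‖ := by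
  rw [annihilateSector, LinearIsometryEquiv.norm_map]
  exact norm_createSector_le f n

variable (μ) in
/-- The action `M ⊗ 1` of a `D × D` matrix on `ℂ^D ⊗ L²(X)^{⊗ n}`. -/
def spinNBody (M : Matrix (Fin D) (Fin D) ℂ) (n : ℕ) : NBody μ D n →L[ℂ] NBody μ D n :=
  (Matrix.toEuclideanCLM (n := Fin D) (𝕜 := ℂ) M).compLpL 2 (Measure.pi (fun _ : Fin n => μ))

theorem spinNBody_mem (M : Matrix (Fin D) (Fin D) ℂ) (n : ℕ) (ψ : Sector μ D n) :
    spinNBody μ M n ψ ∈ symSubmodule μ D n := by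
  intro σ
  have hσ := measurePreserving_perm μ σ
  have h0 := ψ.2 σ
  conv_rhs => rw [← h0]
  refine Lp.ext ?_
  set L := Matrix.toEuclideanCLM (n := Fin D) (𝕜 := ℂ) M
  have e1 := Lp.coeFn_compMeasurePreserving (spinNBody μ M n ψ) hσ
  have e2 := hσ.quasiMeasurePreserving.ae (L.coeFn_compLpL (p := 2) (ψ : NBody μ D n))
  have e3 := L.coeFn_compLpL (p := 2) (permute μ D σ (ψ : NBody μ D n))
  have e4 := Lp.coeFn_compMeasurePreserving (ψ : NBody μ D n) hσ
  filter_upwards [e1, e2, e3, e4] with k h1 h2 h3 h4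
  exact h1.trans (h2.trans ((congrArg L h4.symm).trans h3.symm))

variable (μ) in
/-- The action `M ⊗ 1` of a `D × D` matrix on the `n`-boson sector. -/
def spinSector (M : Matrix (Fin D) (Fin D) ℂ) (n : ℕ) : Sector μ D n →L[ℂ] Sector μ D n :=
  (spinNBody μ M n ∘L (symSubmodule μ D n).subtypeL).codRestrict (symSubmodule μ D n)
    (spinNBody_mem M n)

theorem norm_spinSector_le (M : Matrix (Fin D) (Fin D) ℂ) (n : ℕ) :
    ‖spinSector μ M n‖ ≤ ‖Matrix.toEuclideanCLM (n := Fin D) (𝕜 := ℂ) M‖ :=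
  ContinuousLinearMap.opNorm_le_bound _ (norm_nonneg _) fun ψ =>
    ContinuousLinearMap.norm_compLp_le _ (ψ : NBody μ D n)

end Sectors

section Fock

variable {X : Type*} [MeasurableSpace X] (μ : Measure X) [SigmaFinite μ] (D : ℕ)

/-- Arbitrary sequences of `n`-boson components. -/
abbrev FormalFock : Type _ := ∀ n : ℕ, Sector μ D n

/-- The Hilbert space `ℂ^D ⊗ 𝓕`, with `𝓕 = ⨁ₙ S_n L²(X)^{⊗ n}` the bosonic Fock space. -/
abbrev Fock : Type _ := lp (fun n : ℕ => Sector μ D n) 2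

variable {D} in
/-- The vector `v ⊗ Ω`, with `Ω` the vacuum. -/
def vacuum (v : EuclideanSpace ℂ (Fin D)) : Fock μ D :=
  lp.single 2 0
    (⟨indicatorConstLp 2 MeasurableSet.univ (by simp) v, fun σ => by
      rw [Subsingleton.elim σ 1]
      exact Lp.compMeasurePreserving_id_apply _⟩ : Sector μ D 0)

/-- The form domain of the number operator: `Ψ` with `∑ₙ n ‖Ψ⁽ⁿ⁾‖² < ∞`. This is the domain
of the square root of the number operator. -/
def numberHalfDomain : Submodule ℂ (Fock μ D) where
  carrier := {Ψ | Summable fun n : ℕ => (n : ℝ) * ‖Ψ n‖ ^ 2}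
  zero_mem' := by simp
  add_mem' {Ψ Φ} hΨ hΦ := by
    refine Summable.of_nonneg_of_le (fun n => by positivity) (fun n => ?_)
      ((hΨ.mul_left 2).add (hΦ.mul_left 2))
    have h1 : ‖(Ψ + Φ) n‖ ≤ ‖Ψ n‖ + ‖Φ n‖ := norm_add_le _ _
    have h2 : ‖(Ψ + Φ) n‖ ^ 2 ≤ 2 * ‖Ψ n‖ ^ 2 + 2 * ‖Φ n‖ ^ 2 := by
      nlinarith [norm_nonneg ((Ψ + Φ) n), sq_nonneg (‖Ψ n‖ - ‖Φ n‖)]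
    nlinarith [mul_le_mul_of_nonneg_left h2 (Nat.cast_nonneg (α := ℝ) n)]
  smul_mem' c Ψ hΨ := by
    refine (hΨ.mul_left (‖c‖ ^ 2)).congr fun n => ?_
    have : ‖(c • Ψ) n‖ = ‖c‖ * ‖Ψ n‖ := norm_smul c (Ψ n)
    rw [this]
    ring

variable {μ D}

/-- The operator on a given domain acting as a given operator on sequences of components. -/
def ofFormal (A : FormalFock μ D →ₗ[ℂ] FormalFock μ D) (V : Submodule ℂ (Fock μ D))
    (h : ∀ Ψ ∈ V, Memℓp (A (fun n => Ψ n)) 2) : Fock μ D →ₗ.[ℂ] Fock μ D where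
  domain := V
  toFun :=
    { toFun := fun Ψ => ⟨A (fun n => (Ψ : Fock μ D) n), h Ψ Ψ.2⟩
      map_add' := fun Ψ _ => Subtype.ext (map_add A (fun n => (Ψ : Fock μ D) n) _)
      map_smul' := fun c Ψ => Subtype.ext (map_smul A c (fun n => (Ψ : Fock μ D) n)) }

/-- The domain of all `Ψ` for which the sequence `A Ψ` is square summable. -/
def maximalDomain (A : FormalFock μ D →ₗ[ℂ] FormalFock μ D) : Submodule ℂ (Fock μ D) where
  carrier := {Ψ | Memℓp (A (fun n => Ψ n)) 2}
  zero_mem' := by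
    have : A (fun n => (0 : Fock μ D) n) = 0 := map_zero A
    simpa only [Set.mem_ofPred_eq, this] using zero_memℓp
  add_mem' {Ψ Φ} hΨ hΦ := by
    have : A (fun n => (Ψ + Φ) n) = A (fun n => Ψ n) + A (fun n => Φ n) :=
      map_add A (fun n => Ψ n) _
    simpa only [Set.mem_ofPred_eq, this] using Memℓp.add hΨ hΦ
  smul_mem' c Ψ hΨ := by
    have : A (fun n => (c • Ψ) n) = c • A (fun n => Ψ n) := map_smul A c (fun n => Ψ n)
    simpa only [Set.mem_ofPred_eq, this] using Memℓp.const_smul hΨ c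

variable (D) in
/-- `(a*(f) Ψ)⁽⁰⁾ = 0` and `(a*(f) Ψ)⁽ⁿ⁺¹⁾ = a*(f) Ψ⁽ⁿ⁾`. -/
def createFormal (f : Lp ℂ 2 μ) : FormalFock μ D →ₗ[ℂ] FormalFock μ D :=
  LinearMap.pi fun n =>
    match n with
    | 0 => 0
    | n + 1 => (createSector D f n).toLinearMap ∘ₗ LinearMap.proj n

variable (D) in
/-- `(a(f) Ψ)⁽ⁿ⁾ = a(f) Ψ⁽ⁿ⁺¹⁾`. -/
def annihilateFormal (f : Lp ℂ 2 μ) : FormalFock μ D →ₗ[ℂ] FormalFock μ D :=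
  LinearMap.pi fun n => (annihilateSector D f n).toLinearMap ∘ₗ LinearMap.proj (n + 1)

variable (μ) in
/-- `((M ⊗ 1) Ψ)⁽ⁿ⁾ = (M ⊗ 1) Ψ⁽ⁿ⁾`. -/
def spinFormal (M : Matrix (Fin D) (Fin D) ℂ) : FormalFock μ D →ₗ[ℂ] FormalFock μ D :=
  LinearMap.pi fun n => (spinSector μ M n).toLinearMap ∘ₗ LinearMap.proj n

theorem summable_sq (Ψ : Fock μ D) : Summable fun n => ‖Ψ n‖ ^ 2 := by
  simpa using (lp.memℓp Ψ).summable (by norm_num)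

theorem memℓp_two {Ψ : FormalFock μ D} (h : Summable fun n => ‖Ψ n‖ ^ 2) : Memℓp Ψ 2 :=
  memℓp_gen (by simpa using h)

theorem memℓp_create (f : Lp ℂ 2 μ) (Ψ : Fock μ D) (hΨ : Ψ ∈ numberHalfDomain μ D) :
    Memℓp (createFormal D f (fun n => Ψ n)) 2 := by
  refine memℓp_two ((summable_nat_add_iff 1).1 ?_)
  refine Summable.of_nonneg_of_le (fun n => by positivity) (fun n => ?_)
    ((hΨ.add (summable_sq Ψ)).mul_left (‖f‖ ^ 2))
  have h : ‖createSector D f n (Ψ n)‖ ≤ Real.sqrt (n + 1) * ‖f‖ * ‖Ψ n‖ :=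
    (createSector D f n).le_of_opNorm_le (norm_createSector_le f n) _
  change ‖createSector D f n (Ψ n)‖ ^ 2 ≤ _
  calc _ ≤ (Real.sqrt (n + 1) * ‖f‖ * ‖Ψ n‖) ^ 2 := by gcongr
    _ = _ := by
      rw [mul_pow, mul_pow, Real.sq_sqrt (by positivity)]
      ring

theorem memℓp_annihilate (f : Lp ℂ 2 μ) (Ψ : Fock μ D) (hΨ : Ψ ∈ numberHalfDomain μ D) :
    Memℓp (annihilateFormal D f (fun n => Ψ n)) 2 := by
  refine memℓp_two ?_
  refine Summable.of_nonneg_of_le (fun n => by positivity) (fun n => ?_)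
    (((summable_nat_add_iff 1).2 hΨ).mul_left (‖f‖ ^ 2))
  have h : ‖annihilateSector D f n (Ψ (n + 1))‖ ≤ Real.sqrt (n + 1) * ‖f‖ * ‖Ψ (n + 1)‖ :=
    (annihilateSector D f n).le_of_opNorm_le (norm_annihilateSector_le f n) _
  change ‖annihilateSector D f n (Ψ (n + 1))‖ ^ 2 ≤ _
  calc _ ≤ (Real.sqrt (n + 1) * ‖f‖ * ‖Ψ (n + 1)‖) ^ 2 := by gcongr
    _ = _ := by
      rw [mul_pow, mul_pow, Real.sq_sqrt (by positivity)]
      push_cast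
      ring

variable (D) in
/-- The creation operator `a*(f)` on the domain of the square root of the number operator. -/
def creation (f : Lp ℂ 2 μ) : Fock μ D →ₗ.[ℂ] Fock μ D :=
  ofFormal (createFormal D f) (numberHalfDomain μ D) (memℓp_create f)

variable (D) in
/-- The annihilation operator `a(f)` on the domain of the square root of the number operator. -/
def annihilation (f : Lp ℂ 2 μ) : Fock μ D →ₗ.[ℂ] Fock μ D :=
  ofFormal (annihilateFormal D f) (numberHalfDomain μ D) (memℓp_annihilate f)

variable (μ) in
/-- The bounded operator `M ⊗ 1` on `ℂ^D ⊗ 𝓕`. -/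
def spin (M : Matrix (Fin D) (Fin D) ℂ) : Fock μ D →L[ℂ] Fock μ D :=
  lp.mapCLM 2 (spinSector μ M) (norm_nonneg _) (norm_spinSector_le M)

end Fock

section Model

variable {X : Type*} [MeasurableSpace X] {μ : Measure X}

variable (μ) in
/-- The domain of the operator of multiplication by `ω` on `L²(X)`: all `φ` with `ω φ ∈ L²(X)`. -/
def mulDomain (ω : X → ℝ) : Submodule ℂ (Lp ℂ 2 μ) where
  carrier := {φ | MemLp (fun x => (ω x : ℂ) * φ x) 2 μ}
  zero_mem' := by
    refine (memLp_congr_ae ?_).2 (MemLp.zero (ε := ℂ))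
    filter_upwards [Lp.coeFn_zero ℂ 2 μ] with x hx
    rw [hx, Pi.zero_apply, mul_zero]
  add_mem' := fun {φ χ} hφ hχ => by
    refine (memLp_congr_ae ?_).2 (MemLp.add hφ hχ)
    filter_upwards [Lp.coeFn_add φ χ] with x hx
    rw [hx, Pi.add_apply, mul_add, Pi.add_apply]
  smul_mem' := fun c φ hφ => by
    refine (memLp_congr_ae ?_).2 (MemLp.const_smul hφ c)
    filter_upwards [Lp.coeFn_smul c φ] with x hx
    rw [hx, Pi.smul_apply, Pi.smul_apply, smul_eq_mul, smul_eq_mul, mul_left_comm]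

theorem memLp_mul {ω : X → ℝ} (φ : mulDomain μ ω) :
    MemLp (fun x => (ω x : ℂ) * (φ : Lp ℂ 2 μ) x) 2 μ := φ.2

variable (μ) in
/-- The operator of multiplication by a real function on `L²(X)`, on its maximal domain. -/
def mulOp (ω : X → ℝ) : Lp ℂ 2 μ →ₗ.[ℂ] Lp ℂ 2 μ where
  domain := mulDomain μ ω
  toFun :=
    { toFun := fun φ => (memLp_mul φ).toLp
      map_add' := fun φ χ => by
        rw [← MemLp.toLp_add]
        refine MemLp.toLp_congr _ _ ?_
        filter_upwards [Lp.coeFn_add (φ : Lp ℂ 2 μ) χ] with x hx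
        rw [Submodule.coe_add, hx, Pi.add_apply, mul_add, Pi.add_apply]
      map_smul' := fun c φ => by
        rw [RingHom.id_apply, ← MemLp.toLp_const_smul]
        refine MemLp.toLp_congr _ _ ?_
        filter_upwards [Lp.coeFn_smul c (φ : Lp ℂ 2 μ)] with x hx
        rw [Submodule.coe_smul, hx, Pi.smul_apply, Pi.smul_apply, smul_eq_mul, smul_eq_mul,
          mul_left_comm] }

variable {D N : ℕ}

/-- The functions `f_j / ω` as elements of `L²(X)`. Below they are denoted by `g j`. -/
def ratio {f : Fin N → X → ℂ} {ω : X → ℝ}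
    (h : ∀ j, MemLp (fun x => f j x / (ω x : ℂ)) 2 μ) : Fin N → Lp ℂ 2 μ :=
  fun j => (h j).toLp

variable [SigmaFinite μ]

/-- The operator `-∑ⱼ Bⱼ a*(gⱼ)` on sequences of components. -/
def dressingGenerator (B : Fin N → Matrix (Fin D) (Fin D) ℂ) (g : Fin N → Lp ℂ 2 μ) :
    FormalFock μ D →ₗ[ℂ] FormalFock μ D :=
  -∑ j, spinFormal μ (B j) ∘ₗ createFormal D (g j)

/-- `∑ₙ (1/n!) Gⁿ` on sequences of components, with `G = -∑ⱼ Bⱼ a*(gⱼ)`. As `G` creates exactly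
one boson, only the terms with `n ≤ m` contribute to the `m`-boson component. -/
def dressingFormal (B : Fin N → Matrix (Fin D) (Fin D) ℂ) (g : Fin N → Lp ℂ 2 μ) :
    FormalFock μ D →ₗ[ℂ] FormalFock μ D :=
  LinearMap.pi fun m => ∑ n ∈ Finset.range (m + 1),
    ((n.factorial : ℂ)⁻¹) • (LinearMap.proj m ∘ₗ (dressingGenerator B g ^ n))

theorem dressingGenerator_pow_apply_eq_zero (B : Fin N → Matrix (Fin D) (Fin D) ℂ)
    (g : Fin N → Lp ℂ 2 μ) (Ψ : FormalFock μ D) :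
    ∀ n m : ℕ, m < n → (dressingGenerator B g ^ n) Ψ m = 0 := by
  intro n
  induction n with
  | zero => intro m hm; omega
  | succ n ih =>
    intro m hm
    rw [pow_succ', Module.End.mul_apply]
    cases m with
    | zero => simp [dressingGenerator, spinFormal, createFormal]
    | succ m =>
      have := ih m (by omega)
      simp [dressingGenerator, spinFormal, createFormal] at this ⊢
      simp [this]

theorem hasSum_dressingFormal (B : Fin N → Matrix (Fin D) (Fin D) ℂ) (g : Fin N → Lp ℂ 2 μ)
    (Ψ : FormalFock μ D) (m : ℕ) :
    HasSum (fun n : ℕ => ((n.factorial : ℂ)⁻¹) • (dressingGenerator B g ^ n) Ψ m)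
      (dressingFormal B g Ψ m) := by
  have h : dressingFormal B g Ψ m = ∑ n ∈ Finset.range (m + 1),
      ((n.factorial : ℂ)⁻¹) • (dressingGenerator B g ^ n) Ψ m := by
    simp [dressingFormal]
  rw [h]
  refine hasSum_sum_of_ne_finset_zero fun n hn => ?_
  rw [dressingGenerator_pow_apply_eq_zero B g Ψ n m (by simpa using hn), smul_zero]

/-- The dressing operator `T = exp(-∑ⱼ Bⱼ a*(gⱼ))` on its maximal domain. -/
def dressing (B : Fin N → Matrix (Fin D) (Fin D) ℂ) (g : Fin N → Lp ℂ 2 μ) :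
    Fock μ D →ₗ.[ℂ] Fock μ D :=
  ofFormal (dressingFormal B g) (maximalDomain (dressingFormal B g)) fun _ h => h

/-- The displaced annihilation operator `â(h) = a(h) + ∑ⱼ ⟨h, gⱼ⟩ Bⱼ`. -/
def displaced (B : Fin N → Matrix (Fin D) (Fin D) ℂ) (g : Fin N → Lp ℂ 2 μ) (h : Lp ℂ 2 μ) :
    Fock μ D →ₗ.[ℂ] Fock μ D :=
  (∑ j, ⟪h, g j⟫_ℂ • (spin μ (B j)).toLinearMap) +ᵥ annihilation D h

variable {ι : Type*}

/-- `IsDressed B g e v [ℓ₁, …, ℓₙ] Ψ` says that `a*(e_ℓ₁) ⋯ a*(e_ℓₙ) T (v ⊗ Ω)` is defined, every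
operator being applied to a vector of its domain, and is equal to `Ψ`. -/
def IsDressed (B : Fin N → Matrix (Fin D) (Fin D) ℂ) (g : Fin N → Lp ℂ 2 μ) (e : ι → Lp ℂ 2 μ)
    (v : EuclideanSpace ℂ (Fin D)) : List ι → Fock μ D → Prop
  | [], Ψ => (vacuum μ v, Ψ) ∈ (dressing B g).graph
  | l :: ls, Ψ => ∃ Φ, IsDressed B g e v ls Φ ∧ (Φ, Ψ) ∈ (creation D (e l)).graph

/-- The span of the dressed test vectors. -/
def testDomain (B : Fin N → Matrix (Fin D) (Fin D) ℂ) (g : Fin N → Lp ℂ 2 μ)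
    (e : ι → Lp ℂ 2 μ) : Submodule ℂ (Fock μ D) :=
  Submodule.span ℂ {Ψ | ∃ v ls, IsDressed B g e v ls Ψ}

/-- `∑_{ℓ,ℓ'} ⟨e_ℓ, ω e_ℓ'⟩ â_ℓ* â_ℓ' Ψ + K Ψ` is defined and equal to `Φ`: the vector `Ψ` lies in
the domain of every `â_ℓ'`, every `â_ℓ' Ψ` in the domain of every adjoint `â_ℓ*`, and the double
series converges unconditionally in norm. -/
def HasRenormalizedAction (K : Matrix (Fin D) (Fin D) ℂ) (B : Fin N → Matrix (Fin D) (Fin D) ℂ)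
    (g : Fin N → Lp ℂ 2 μ) (ω : X → ℝ) (e : ι → Lp ℂ 2 μ)
    (he : ∀ l, e l ∈ (mulOp μ ω).domain) (Ψ Φ : Fock μ D) : Prop :=
  ∃ (u : ι → Fock μ D) (w : ι → ι → Fock μ D),
    (∀ l', (Ψ, u l') ∈ (displaced B g (e l')).graph) ∧
    (∀ l l', (u l', w l l') ∈ ((displaced B g (e l))†).graph) ∧
    ∃ S, HasSum (fun p : ι × ι => ⟪e p.1, mulOp μ ω ⟨e p.2, he p.2⟩⟫_ℂ • w p.1 p.2) S ∧
      Φ = S + spin μ K Ψ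

end Model

section Friedrichs

variable {E : Type*} [NormedAddCommGroup E] [InnerProductSpace ℂ E]

/-- `⟨ψ, A ψ⟩ ≥ c ‖ψ‖²` on the domain of `A`. -/
def IsBoundedBelowBy (A : E →ₗ.[ℂ] E) (c : ℝ) : Prop :=
  ∀ ψ : A.domain, c * ‖(ψ : E)‖ ^ 2 ≤ (⟪(ψ : E), A ψ⟫_ℂ).re

/-- The domain of the closure of the quadratic form `ψ ↦ ⟨ψ, A ψ⟩` of a symmetric operator `A`
that is bounded below: limits of sequences in the domain of `A` that are Cauchy with respect to
the form. -/
def formDomain (A : E →ₗ.[ℂ] E) : Set E :=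
  {ψ | ∃ u : ℕ → A.domain, Tendsto (fun n => (u n : E)) atTop (𝓝 ψ) ∧
    Tendsto (fun p : ℕ × ℕ => (⟪((u p.1 - u p.2 : A.domain) : E), A (u p.1 - u p.2)⟫_ℂ).re)
      atTop (𝓝 0)}

/-- `F` is the Friedrichs extension of `A`: the restriction of the adjoint of `A` to the vectors
of its domain that lie in the form domain of `A`. -/
def IsFriedrichsExtension [CompleteSpace E] (A F : E →ₗ.[ℂ] E) : Prop :=
  F ≤ A† ∧ ∀ ψ, ψ ∈ F.domain ↔ ψ ∈ A†.domain ∧ ψ ∈ formDomain A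

end Friedrichs

end GSB

end

/-!
For commuting `Bⱼ` the dressed vacuum `T (v ⊗ Ω)` is the only solution of `𝒩 Ψ = G Ψ` with vacuum
component `v`, where `𝒩` is the number operator. Commuting `â(h)` through this equation shows that
`â(h) T (v ⊗ Ω)` solves it shifted by one boson, so it vanishes: on dressed test vectors `â(h)`
acts by removing creation operators, exactly as `a(h)` does on undressed ones. Hence only finitely
many `â_ℓ' Ψ` are nonzero, and for each of them the sum over `ℓ` is the expansion of `ω e_ℓ'` in the
basis. The matrices `⟨e_ℓ, ω e_ℓ'⟩` and `⟨â_ℓ Ψ, â_ℓ' Ψ⟩` are positive semidefinite, so by the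
Schur product theorem `⟨Ψ, H Ψ⟩ ≥ ⟨Ψ, K Ψ⟩ ≥ -‖K‖ ‖Ψ‖²`.

For density, the closure of the span contains the vectors with arbitrary creation operators and is
invariant under `𝒩`, because `𝒩 T v = G T v`. If `Φ` is orthogonal to it, then all moments
`∑ₙ nᵏ ⟨Φ⁽ⁿ⁾, Ψ⁽ⁿ⁾⟩` vanish; as dressed vectors decay faster than exponentially in the boson
number, this forces `⟨Φ⁽ⁿ⁾, Ψ⁽ⁿ⁾⟩ = 0` for each `n`. The lowest component of a dressed test vector
is an arbitrary symmetrized product, so `Φ = 0`.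

The Friedrichs extension comes from the completion of the domain in the form norm: if `j` embeds it
into the Hilbert space, then `j j*` inverts the operator shifted to have lower bound `1`.
-/

noncomputable section

namespace GSB

section Rectangles

variable {α β G : Type*} [MeasurableSpace α] [MeasurableSpace β] [NormedAddCommGroup G]
  [NormedSpace ℝ G]

theorem setIntegral_eq_zero_of_setIntegral_prod_eq_zero {ρ : Measure (α × β)} {Φ : α × β → G}
    (hΦ : Integrable Φ ρ)
    (h : ∀ s t, MeasurableSet s → MeasurableSet t → ∫ p in s ×ˢ t, Φ p ∂ρ = 0)
    {C : Set (α × β)} (hC : MeasurableSet C) : ∫ p in C, Φ p ∂ρ = 0 := by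
  induction C, hC using MeasurableSpace.induction_on_inter generateFrom_prod.symm
    isPiSystem_prod with
  | empty => simp
  | basic C hC =>
    obtain ⟨s, hs, t, ht, rfl⟩ := hC
    exact h s t hs ht
  | compl C hC ih =>
    have htotal : ∫ p, Φ p ∂ρ = 0 := by
      simpa using h Set.univ Set.univ MeasurableSet.univ MeasurableSet.univ
    rwa [← integral_add_compl hC hΦ, ih, zero_add] at htotal
  | iUnion C hd hm ih =>
    rw [integral_iUnion hm hd hΦ.integrableOn]
    simp [ih]

theorem ae_eq_zero_of_setIntegral_prod_eq_zero [CompleteSpace G] {μ : Measure α} {ν : Measure β}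
    [SigmaFinite μ] [SigmaFinite ν] {p : ℝ≥0∞} (hp : 1 ≤ p) {Φ : α × β → G}
    (hΦ : MemLp Φ p (μ.prod ν))
    (h : ∀ s t, MeasurableSet s → MeasurableSet t → μ s ≠ ∞ → ν t ≠ ∞ →
      ∫ p in s ×ˢ t, Φ p ∂(μ.prod ν) = 0) : Φ =ᵐ[μ.prod ν] 0 := by
  let R : ℕ × ℕ → Set (α × β) := fun k => spanningSets μ k.1 ×ˢ spanningSets ν k.2
  have hR : ⋃ k, R k = Set.univ := by
    rw [← Set.univ_prod_univ, ← iUnion_spanningSets μ, ← iUnion_spanningSets ν, Set.iUnion_prod]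
  have hzero : ∀ k, ∀ᵐ p ∂((μ.prod ν).restrict (R k)), Φ p = 0 := by
    intro k
    have hμ : μ (spanningSets μ k.1) < ∞ := measure_spanningSets_lt_top μ _
    have hν : ν (spanningSets ν k.2) < ∞ := measure_spanningSets_lt_top ν _
    have : IsFiniteMeasure ((μ.prod ν).restrict (R k)) :=
      isFiniteMeasure_restrict.2 (by
        rw [Measure.prod_prod]
        exact (ENNReal.mul_lt_top hμ hν).ne)
    have hint : Integrable Φ ((μ.prod ν).restrict (R k)) := (hΦ.restrict _).integrable hp
    refine hint.ae_eq_zero_of_forall_setIntegral_eq_zero fun C hC _ =>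
      setIntegral_eq_zero_of_setIntegral_prod_eq_zero hint (fun s t hs ht => ?_) hC
    rw [Measure.restrict_restrict (hs.prod ht), Set.prod_inter_prod]
    exact h _ _ (hs.inter (measurableSet_spanningSets μ _))
      (ht.inter (measurableSet_spanningSets ν _))
      ((measure_mono Set.inter_subset_right).trans_lt hμ).ne
      ((measure_mono Set.inter_subset_right).trans_lt hν).ne
  have := (ae_restrict_iUnion_iff R (fun p => Φ p = 0)).2 hzero
  rwa [hR, Measure.restrict_univ] at this

end Rectangles

section Tensor

variable {X : Type*} [MeasurableSpace X] {μ : Measure X} [SigmaFinite μ] {D : ℕ}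

theorem coeFn_tensor (f : Lp ℂ 2 μ) {n : ℕ} (ψ : NBody μ D n) :
    tensor f ψ =ᵐ[Measure.pi (fun _ : Fin (n + 1) => μ)] fun k => f (k 0) • ψ (Fin.tail k) :=
  (memLp_tensor f ψ).coeFn_toLp

theorem ae_head {n : ℕ} {p : X → Prop} (h : ∀ᵐ x ∂μ, p x) :
    ∀ᵐ k ∂(Measure.pi (fun _ : Fin (n + 1) => μ)), p (k 0) :=
  (Measure.quasiMeasurePreserving_fst.comp (measurePreserving_piFinSuccAbove
    (fun _ : Fin (n + 1) => μ) 0).quasiMeasurePreserving).ae h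

theorem inner_tensor (f g : Lp ℂ 2 μ) {n : ℕ} (ψ φ : NBody μ D n) :
    ⟪tensor f ψ, tensor g φ⟫_ℂ = ⟪f, g⟫_ℂ * ⟪ψ, φ⟫_ℂ := by
  rw [L2.inner_def, L2.inner_def, L2.inner_def, ← integral_prod_mul,
    ← (measurePreserving_piFinSuccAbove (fun _ : Fin (n + 1) => μ) 0).integral_comp']
  refine integral_congr_ae ?_
  filter_upwards [coeFn_tensor f ψ, coeFn_tensor g φ] with k hfψ hgφ
  rw [hfψ, hgφ, inner_smul_left, inner_smul_right, ← mul_assoc]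
  congr 1
  rw [RCLike.inner_apply', mul_comm]
  exact mul_comm _ _

theorem tensor_smul (f : Lp ℂ 2 μ) {n : ℕ} (c : ℂ) (ψ : NBody μ D n) :
    tensor f (c • ψ) = c • tensor f ψ := map_smul (tensorL D f n) c ψ

theorem tensor_sum (f : Lp ℂ 2 μ) {n : ℕ} {κ : Type*} (s : Finset κ) (ψ : κ → NBody μ D n) :
    tensor f (∑ i ∈ s, ψ i) = ∑ i ∈ s, tensor f (ψ i) := map_sum (tensorL D f n) ψ s

theorem add_tensor (f g : Lp ℂ 2 μ) {n : ℕ} (ψ : NBody μ D n) :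
    tensor (f + g) ψ = tensor f ψ + tensor g ψ := by
  refine Lp.ext ?_
  filter_upwards [coeFn_tensor (f + g) ψ, coeFn_tensor f ψ, coeFn_tensor g ψ,
    Lp.coeFn_add (tensor f ψ) (tensor g ψ), ae_head (Lp.coeFn_add f g)] with k hsum hf hg hadd hfg
  rw [hsum, hadd, Pi.add_apply, hf, hg, hfg, Pi.add_apply, add_smul]

theorem smul_tensor (c : ℂ) (f : Lp ℂ 2 μ) {n : ℕ} (ψ : NBody μ D n) :
    tensor (c • f) ψ = c • tensor f ψ := by
  refine Lp.ext ?_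
  filter_upwards [coeFn_tensor (c • f) ψ, coeFn_tensor f ψ,
    Lp.coeFn_smul c (tensor f ψ), ae_head (Lp.coeFn_smul c f)] with k hcf hf hsmul hcf₀
  rw [hcf, hsmul, Pi.smul_apply, hf, hcf₀, Pi.smul_apply, smul_assoc]

theorem coeFn_permute {n : ℕ} (σ : Equiv.Perm (Fin n)) (ψ : NBody μ D n) :
    permute μ D σ ψ =ᵐ[Measure.pi (fun _ : Fin n => μ)] fun k => ψ (k ∘ σ) :=
  Lp.coeFn_compMeasurePreserving ψ (measurePreserving_perm μ σ)

theorem permute_one {n : ℕ} (ψ : NBody μ D n) : permute μ D 1 ψ = ψ :=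
  Lp.compMeasurePreserving_id_apply _

theorem inner_permute_left {n : ℕ} (σ : Equiv.Perm (Fin n)) (ψ φ : NBody μ D n) :
    ⟪permute μ D σ ψ, φ⟫_ℂ = ⟪ψ, permute μ D σ⁻¹ φ⟫_ℂ := by
  rw [← LinearIsometry.inner_map_map (permute μ D σ) ψ, permute_permute, mul_inv_cancel,
    permute_one]

theorem permute_tensor {n : ℕ} (σ : Equiv.Perm (Fin n)) (f : Lp ℂ 2 μ) (ψ : NBody μ D n) :
    permute μ D (Equiv.Perm.decomposeFin.symm (0, σ)) (tensor f ψ) =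
      tensor f (permute μ D σ ψ) := by
  refine Lp.ext ?_
  filter_upwards [coeFn_permute (Equiv.Perm.decomposeFin.symm (0, σ)) (tensor f ψ),
    (measurePreserving_perm μ (Equiv.Perm.decomposeFin.symm (0, σ))).quasiMeasurePreserving.ae
      (coeFn_tensor f ψ), coeFn_tensor f (permute μ D σ ψ), ae_tail (coeFn_permute σ ψ)]
    with k hperm hf hfperm htail
  rw [hperm, hf, hfperm, htail]
  have hhead : (k ∘ (Equiv.Perm.decomposeFin.symm ((0 : Fin (n + 1)), σ))) 0 = k 0 := by
    simp
  have htail_comp : Fin.tail (k ∘ (Equiv.Perm.decomposeFin.symm ((0 : Fin (n + 1)), σ))) =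
      Fin.tail k ∘ σ := by
    funext i
    simp [Fin.tail]
  rw [hhead, htail_comp]

theorem permute_swap_tensor_tensor {n : ℕ} (f g : Lp ℂ 2 μ) (ψ : NBody μ D n) :
    permute μ D (Equiv.swap 0 1) (tensor f (tensor g ψ)) = tensor g (tensor f ψ) := by
  have e : ∀ f g : Lp ℂ 2 μ, ∀ᵐ k ∂(Measure.pi (fun _ : Fin (n + 2) => μ)),
      tensor f (tensor g ψ) k = f (k 0) • g (k 1) • ψ (Fin.tail (Fin.tail k)) := by
    intro f g
    filter_upwards [coeFn_tensor f (tensor g ψ), ae_tail (coeFn_tensor g ψ)] with k hf hg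
    rw [hf, hg]
    rfl
  refine Lp.ext ?_
  filter_upwards [coeFn_permute (Equiv.swap 0 1) (tensor f (tensor g ψ)),
    (measurePreserving_perm μ (Equiv.swap (0 : Fin (n + 2)) 1)).quasiMeasurePreserving.ae (e f g),
    e g f] with k hperm hfg hgf
  rw [hperm, hfg, hgf, smul_comm]
  have htail : Fin.tail (Fin.tail (k ∘ Equiv.swap (0 : Fin (n + 2)) 1)) =
      Fin.tail (Fin.tail k) := by
    funext i
    simp only [Fin.tail, Function.comp_apply]
    rw [Equiv.swap_apply_of_ne_of_ne (Fin.succ_ne_zero _)]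
    rw [← Fin.succ_zero_eq_one, Ne, Fin.succ_inj]
    exact Fin.succ_ne_zero _
  simp [htail]

theorem tensor_indicatorConstLp {n : ℕ} {s : Set X} {t : Set (Fin n → X)} (hs : MeasurableSet s)
    (ht : MeasurableSet t) (hμs : μ s ≠ ∞) (hμt : Measure.pi (fun _ : Fin n => μ) t ≠ ∞)
    (hst : MeasurableSet (MeasurableEquiv.piFinSuccAbove (fun _ => X) 0 ⁻¹' (s ×ˢ t)))
    (hμst : Measure.pi (fun _ : Fin (n + 1) => μ)
      (MeasurableEquiv.piFinSuccAbove (fun _ => X) 0 ⁻¹' (s ×ˢ t)) ≠ ∞)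
    (v : EuclideanSpace ℂ (Fin D)) :
    tensor (indicatorConstLp 2 hs hμs 1) (indicatorConstLp 2 ht hμt v) =
      indicatorConstLp 2 hst hμst v := by
  refine Lp.ext ?_
  filter_upwards [coeFn_tensor (indicatorConstLp 2 hs hμs (1 : ℂ))
    (indicatorConstLp 2 ht hμt v : NBody μ D n),
    indicatorConstLp_coeFn (p := 2) (hs := hst) (hμs := hμst) (c := v),
    ae_head (n := n) (indicatorConstLp_coeFn (p := 2) (hs := hs) (hμs := hμs) (c := (1 : ℂ))),
    ae_tail (indicatorConstLp_coeFn (p := 2) (hs := ht) (hμs := hμt) (c := v))]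
    with k htensor hst_k hs_k ht_k
  rw [htensor, hst_k, hs_k, ht_k]
  by_cases hks : k 0 ∈ s <;> by_cases hkt : Fin.tail k ∈ t <;>
    simp [Set.indicator, hks, hkt]

theorem eq_zero_of_inner_tensor_eq_zero {n : ℕ} (φ : NBody μ D (n + 1))
    (h : ∀ (f : Lp ℂ 2 μ) (ψ : NBody μ D n), ⟪tensor f ψ, φ⟫_ℂ = 0) : φ = 0 := by
  set e := MeasurableEquiv.piFinSuccAbove (fun _ : Fin (n + 1) => X) 0 with he
  have hmp := measurePreserving_piFinSuccAbove (fun _ : Fin (n + 1) => μ) 0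
  have hmem : MemLp (fun p => φ (e.symm p)) 2 (μ.prod (Measure.pi (fun _ : Fin n => μ))) :=
    (Lp.memLp φ).comp_measurePreserving (hmp.symm e)
  have hzero : (fun p => φ (e.symm p)) =ᵐ[μ.prod (Measure.pi (fun _ : Fin n => μ))] 0 := by
    refine ae_eq_zero_of_setIntegral_prod_eq_zero one_le_two hmem fun s t hs ht hμs hμt => ?_
    have hst : MeasurableSet (e ⁻¹' (s ×ˢ t)) := e.measurable (hs.prod ht)
    have hμst : Measure.pi (fun _ : Fin (n + 1) => μ) (e ⁻¹' (s ×ˢ t)) ≠ ∞ := by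
      rw [hmp.measure_preimage (hs.prod ht).nullMeasurableSet, Measure.prod_prod]
      exact ENNReal.mul_ne_top hμs hμt
    have hpre : ∫ k in e ⁻¹' (s ×ˢ t), φ k ∂(Measure.pi (fun _ : Fin (n + 1) => μ)) = 0 := by
      refine ext_inner_left ℂ fun v => ?_
      rw [← L2.inner_indicatorConstLp_eq_inner_setIntegral ℂ hst hμst v, inner_zero_right,
        ← tensor_indicatorConstLp hs ht hμs hμt hst hμst, h]
    rw [← hpre, ← hmp.setIntegral_preimage_emb e.measurableEmbedding, he]
    simp only [MeasurableEquiv.symm_apply_apply]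
  refine Lp.ext ?_
  filter_upwards [hmp.quasiMeasurePreserving.ae hzero, Lp.coeFn_zero (EuclideanSpace ℂ (Fin D)) 2
    (Measure.pi (fun _ : Fin (n + 1) => μ))] with k hk hzero_k
  rw [hzero_k, ← e.symm_apply_apply k]
  exact hk

theorem eq_of_inner_tensor_eq {n : ℕ} {φ χ : NBody μ D (n + 1)}
    (h : ∀ (f : Lp ℂ 2 μ) (ψ : NBody μ D n), ⟪tensor f ψ, φ⟫_ℂ = ⟪tensor f ψ, χ⟫_ℂ) : φ = χ :=
  sub_eq_zero.1 (eq_zero_of_inner_tensor_eq_zero _ fun f ψ => by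
    rw [inner_sub_right, h, sub_self])

end Tensor

section SectorOperators

variable {X : Type*} [MeasurableSpace X] {μ : Measure X} [SigmaFinite μ] {D : ℕ}

theorem average_apply {n : ℕ} (ψ : NBody μ D n) :
    average μ D n ψ = ((n.factorial : ℂ)⁻¹) • ∑ σ : Equiv.Perm (Fin n), permute μ D σ ψ := by
  simp [average]

theorem average_of_mem {n : ℕ} {ψ : NBody μ D n} (hψ : ψ ∈ symSubmodule μ D n) :
    average μ D n ψ = ψ := by
  have hn : (n.factorial : ℂ) ≠ 0 := by exact_mod_cast n.factorial_ne_zero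
  rw [average_apply, Finset.sum_congr rfl fun σ _ => hψ σ]
  simp [Fintype.card_perm, ← Nat.cast_smul_eq_nsmul ℂ, smul_smul, hn]

theorem average_permute {n : ℕ} (τ : Equiv.Perm (Fin n)) (ψ : NBody μ D n) :
    average μ D n (permute μ D τ ψ) = average μ D n ψ := by
  simp only [average_apply, permute_permute]
  congr 1
  exact Fintype.sum_equiv (Equiv.mulRight τ) _ _ fun σ => rfl

theorem inner_average_left {n : ℕ} (ψ : NBody μ D n) {φ : NBody μ D n}
    (hφ : φ ∈ symSubmodule μ D n) : ⟪average μ D n ψ, φ⟫_ℂ = ⟪ψ, φ⟫_ℂ := by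
  have hn : (n.factorial : ℂ) ≠ 0 := by exact_mod_cast n.factorial_ne_zero
  rw [average_apply, inner_smul_left, sum_inner,
    Finset.sum_congr rfl fun σ _ => (inner_permute_left σ ψ φ).trans (by rw [hφ])]
  simp [Fintype.card_perm, hn]

theorem decomposeFin_symm_eq_swap_mul {n : ℕ} (p : Fin (n + 1)) (σ : Equiv.Perm (Fin n)) :
    Equiv.Perm.decomposeFin.symm (p, σ) =
      Equiv.swap 0 p * Equiv.Perm.decomposeFin.symm (0, σ) := by
  ext i
  refine Fin.cases ?_ (fun i => ?_) i <;> simp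

theorem average_tensor {n : ℕ} (f : Lp ℂ 2 μ) (ψ : NBody μ D n) :
    average μ D (n + 1) (tensor f ψ) = ((n + 1 : ℂ)⁻¹) •
      ∑ p : Fin (n + 1), permute μ D (Equiv.swap 0 p) (tensor f (average μ D n ψ)) := by
  have hp : ∀ p : Fin (n + 1), permute μ D (Equiv.swap 0 p) (tensor f (average μ D n ψ)) =
      ((n.factorial : ℂ)⁻¹) • ∑ σ : Equiv.Perm (Fin n),
        permute μ D (Equiv.Perm.decomposeFin.symm (p, σ)) (tensor f ψ) := by
    intro p
    rw [average_apply, tensor_smul, map_smul, tensor_sum, map_sum]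
    congr 1
    refine Finset.sum_congr rfl fun σ _ => ?_
    rw [decomposeFin_symm_eq_swap_mul, ← permute_permute, permute_tensor]
  rw [Finset.sum_congr rfl fun p _ => hp p, ← Finset.smul_sum, smul_smul, average_apply,
    ← Fintype.sum_prod_type' (f := fun p σ =>
      permute μ D (Equiv.Perm.decomposeFin.symm (p, σ)) (tensor f ψ)),
    Nat.factorial_succ, Nat.cast_mul, mul_inv]
  push_cast
  congr 1
  exact Fintype.sum_equiv Equiv.Perm.decomposeFin _ _ fun σ => by simp

theorem average_tensor_average {n : ℕ} (f : Lp ℂ 2 μ) (ψ : NBody μ D n) :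
    average μ D (n + 1) (tensor f (average μ D n ψ)) = average μ D (n + 1) (tensor f ψ) := by
  rw [average_tensor, average_of_mem (average_mem μ D n ψ), average_tensor]

theorem coe_createSector (f : Lp ℂ 2 μ) {n : ℕ} (ψ : Sector μ D n) :
    (createSector D f n ψ : NBody μ D (n + 1)) =
      ((Real.sqrt (n + 1) : ℝ) : ℂ) • average μ D (n + 1) (tensor f (ψ : NBody μ D n)) := rfl

theorem createSector_comm (f g : Lp ℂ 2 μ) {n : ℕ} (ψ : Sector μ D n) :
    createSector D f (n + 1) (createSector D g n ψ) =
      createSector D g (n + 1) (createSector D f n ψ) := by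
  refine Subtype.ext ?_
  simp only [coe_createSector, tensor_smul, map_smul, average_tensor_average]
  rw [← average_permute (Equiv.swap 0 1) (tensor f (tensor g _)), permute_swap_tensor_tensor]

theorem createSector_add (f g : Lp ℂ 2 μ) (n : ℕ) :
    createSector D (f + g) n = createSector D f n + createSector D g n := by
  ext1 ψ
  refine Subtype.ext ?_
  simp only [coe_createSector, add_tensor, map_add, smul_add, add_apply,
    Submodule.coe_add]

theorem createSector_smul (c : ℂ) (f : Lp ℂ 2 μ) (n : ℕ) :
    createSector D (c • f) n = c • createSector D f n := by
  ext1 ψ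
  refine Subtype.ext ?_
  simp only [coe_createSector, smul_tensor, map_smul, smul_apply,
    Submodule.coe_smul, smul_comm c]

variable (D) in
/-- The contraction of the first particle with `f`, the adjoint of `ψ ↦ f ⊗ ψ`. -/
def contract (f : Lp ℂ 2 μ) (n : ℕ) : NBody μ D (n + 1) →L[ℂ] NBody μ D n :=
  ContinuousLinearMap.adjoint (tensorL D f n)

theorem inner_contract (f : Lp ℂ 2 μ) {n : ℕ} (ψ : NBody μ D n) (φ : NBody μ D (n + 1)) :
    ⟪ψ, contract D f n φ⟫_ℂ = ⟪tensor f ψ, φ⟫_ℂ :=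
  ContinuousLinearMap.adjoint_inner_right _ _ _

theorem contract_tensor (h f : Lp ℂ 2 μ) {n : ℕ} (ψ : NBody μ D n) :
    contract D h n (tensor f ψ) = ⟪h, f⟫_ℂ • ψ := by
  refine ext_inner_left ℂ fun χ => ?_
  rw [inner_contract, inner_tensor, inner_smul_right]

theorem decomposeFin_symm_zero_inv {n : ℕ} (σ : Equiv.Perm (Fin n)) :
    (Equiv.Perm.decomposeFin.symm (0, σ))⁻¹ = Equiv.Perm.decomposeFin.symm (0, σ⁻¹) := by
  refine inv_eq_of_mul_eq_one_right (Equiv.ext fun i => ?_)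
  refine Fin.cases ?_ (fun i => ?_) i <;> simp

theorem contract_permute (h : Lp ℂ 2 μ) {n : ℕ} (σ : Equiv.Perm (Fin n)) (φ : NBody μ D (n + 1)) :
    contract D h n (permute μ D (Equiv.Perm.decomposeFin.symm (0, σ)) φ) =
      permute μ D σ (contract D h n φ) := by
  refine ext_inner_left ℂ fun χ => ?_
  have hσ := inner_permute_left σ⁻¹ χ (contract D h n φ)
  have hσ' := inner_permute_left (Equiv.Perm.decomposeFin.symm (0, σ))⁻¹ (tensor h χ) φ
  rw [inv_inv] at hσ hσ'
  rw [inner_contract, ← hσ, ← hσ', decomposeFin_symm_zero_inv, permute_tensor, inner_contract]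

theorem contract_mem (f : Lp ℂ 2 μ) {n : ℕ} {φ : NBody μ D (n + 1)}
    (hφ : φ ∈ symSubmodule μ D (n + 1)) : contract D f n φ ∈ symSubmodule μ D n := fun σ => by
  rw [← contract_permute, hφ]

theorem contract_permute_swap_tensor (h f : Lp ℂ 2 μ) {n : ℕ} (ψ : NBody μ D (n + 1)) :
    contract D h (n + 1) (permute μ D (Equiv.swap 0 1) (tensor f ψ)) =
      tensor f (contract D h n ψ) := by
  refine eq_of_inner_tensor_eq fun f' χ => ?_
  have hswap := inner_permute_left (Equiv.swap 0 1) (tensor h (tensor f' χ)) (tensor f ψ)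
  rw [Equiv.swap_inv] at hswap
  rw [inner_contract, ← hswap, permute_swap_tensor_tensor, inner_tensor, inner_tensor,
    inner_contract]

theorem swap_zero_succ {n : ℕ} (q : Fin (n + 1)) :
    Equiv.swap 0 q.succ = Equiv.Perm.decomposeFin.symm (0, Equiv.swap 0 q) *
      Equiv.swap (0 : Fin (n + 2)) 1 * Equiv.Perm.decomposeFin.symm (0, Equiv.swap 0 q) := by
  have h := Equiv.swap_apply_apply (Equiv.Perm.decomposeFin.symm (0, Equiv.swap 0 q)) 0 1
  rw [decomposeFin_symm_zero_inv, Equiv.swap_inv] at h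
  rw [← h, ← Fin.succ_zero_eq_one]
  simp

theorem contract_permute_tensor (h f : Lp ℂ 2 μ) {n : ℕ} {ψ : NBody μ D (n + 1)}
    (hψ : ψ ∈ symSubmodule μ D (n + 1)) (q : Fin (n + 1)) :
    contract D h (n + 1) (permute μ D (Equiv.swap 0 q.succ) (tensor f ψ)) =
      permute μ D (Equiv.swap 0 q) (tensor f (contract D h n ψ)) := by
  rw [swap_zero_succ, ← permute_permute, ← permute_permute, permute_tensor, hψ, contract_permute,
    contract_permute_swap_tensor]

theorem coe_annihilateSector (f : Lp ℂ 2 μ) {n : ℕ} (φ : Sector μ D (n + 1)) :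
    (annihilateSector D f n φ : NBody μ D n) =
      ((Real.sqrt (n + 1) : ℝ) : ℂ) • contract D f n (φ : NBody μ D (n + 1)) := by
  have hmem : ((Real.sqrt (n + 1) : ℝ) : ℂ) • contract D f n (φ : NBody μ D (n + 1)) ∈
      symSubmodule μ D n := Submodule.smul_mem _ _ (contract_mem f φ.2)
  suffices annihilateSector D f n φ = ⟨_, hmem⟩ from congrArg Subtype.val this
  refine ext_inner_left ℂ fun ψ => ?_
  rw [annihilateSector, ContinuousLinearMap.adjoint_inner_right, Submodule.coe_inner,
    Submodule.coe_inner, coe_createSector, inner_smul_left, inner_smul_right,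
    inner_average_left _ φ.2, inner_contract, Complex.conj_ofReal]

theorem sqrt_mul_sqrt_natCast_add_one (n : ℕ) :
    ((Real.sqrt (n + 1) : ℝ) : ℂ) * ((Real.sqrt (n + 1) : ℝ) : ℂ) = n + 1 := by
  rw [← Complex.ofReal_mul, Real.mul_self_sqrt (by positivity)]
  push_cast
  rfl

theorem coe_annihilateSector_createSector (h f : Lp ℂ 2 μ) {n : ℕ} (ψ : Sector μ D n) :
    (annihilateSector D h n (createSector D f n ψ) : NBody μ D n) = ⟪h, f⟫_ℂ • (ψ : NBody μ D n) +
      ∑ q : Fin n, contract D h n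
        (permute μ D (Equiv.swap 0 q.succ) (tensor f (ψ : NBody μ D n))) := by
  have hne : (n + 1 : ℂ) ≠ 0 := by exact_mod_cast n.succ_ne_zero
  have hdiag : contract D h n (permute μ D (Equiv.swap 0 0) (tensor f (ψ : NBody μ D n))) =
      ⟪h, f⟫_ℂ • (ψ : NBody μ D n) := by
    rw [Equiv.swap_self]
    exact (congrArg _ (permute_one _)).trans (contract_tensor _ _ _)
  rw [coe_annihilateSector, coe_createSector, map_smul, smul_smul, sqrt_mul_sqrt_natCast_add_one,
    average_tensor, average_of_mem ψ.2, map_smul, smul_smul, mul_inv_cancel₀ hne, one_smul,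
    map_sum, Fin.sum_univ_succ, hdiag]

theorem annihilateSector_createSector_zero (h f : Lp ℂ 2 μ) (ψ : Sector μ D 0) :
    annihilateSector D h 0 (createSector D f 0 ψ) = ⟪h, f⟫_ℂ • ψ := by
  refine Subtype.ext ?_
  rw [coe_annihilateSector_createSector, Fin.sum_univ_zero, add_zero]
  rfl

theorem annihilateSector_createSector_succ (h f : Lp ℂ 2 μ) {n : ℕ} (ψ : Sector μ D (n + 1)) :
    annihilateSector D h (n + 1) (createSector D f (n + 1) ψ) =
      createSector D f n (annihilateSector D h n ψ) + ⟪h, f⟫_ℂ • ψ := by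
  have hne : (n + 1 : ℂ) ≠ 0 := by exact_mod_cast n.succ_ne_zero
  refine Subtype.ext ?_
  rw [Submodule.coe_add, coe_annihilateSector_createSector, coe_createSector,
    coe_annihilateSector, tensor_smul, map_smul, smul_smul, sqrt_mul_sqrt_natCast_add_one,
    average_tensor, average_of_mem (contract_mem h ψ.2), smul_smul, mul_inv_cancel₀ hne, one_smul,
    Finset.sum_congr rfl fun q _ => contract_permute_tensor h f ψ.2 q]
  exact add_comm _ _

theorem eq_zero_of_annihilateSector_eq_zero {n : ℕ} {φ : Sector μ D (n + 1)}
    (h : ∀ f : Lp ℂ 2 μ, annihilateSector D f n φ = 0) : φ = 0 := by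
  refine Subtype.ext (eq_zero_of_inner_tensor_eq_zero _ fun f ψ => ?_)
  have hf := coe_annihilateSector f φ
  rw [h, Submodule.coe_zero] at hf
  have hsqrt : ((Real.sqrt (n + 1) : ℝ) : ℂ) ≠ 0 := by
    exact_mod_cast (Real.sqrt_pos.2 (by positivity)).ne'
  rw [← inner_contract, (smul_eq_zero.1 hf.symm).resolve_left hsqrt, inner_zero_right]

theorem coe_vacuum_zero (v : EuclideanSpace ℂ (Fin D)) :
    (vacuum μ v 0 : NBody μ D 0) = indicatorConstLp 2 MeasurableSet.univ (by simp) v := by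
  rw [vacuum, lp.single_apply_self]

theorem coeFn_vacuum_zero (v : EuclideanSpace ℂ (Fin D)) :
    (vacuum μ v 0 : NBody μ D 0) =ᵐ[Measure.pi (fun _ : Fin 0 => μ)] fun _ => v := by
  rw [coe_vacuum_zero]
  exact indicatorConstLp_coeFn.trans (by simp)

theorem exists_vacuum_zero_eq (ψ : Sector μ D 0) : ∃ v, vacuum μ v 0 = ψ := by
  refine ⟨(ψ : NBody μ D 0) default, Subtype.ext (Lp.ext ?_)⟩
  filter_upwards [coeFn_vacuum_zero (μ := μ) ((ψ : NBody μ D 0) default)] with k hk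
  rw [hk, Subsingleton.elim k default]

end SectorOperators

section SpinSector

variable {X : Type*} [MeasurableSpace X] {μ : Measure X} {D : ℕ}

theorem coeFn_spinNBody (M : Matrix (Fin D) (Fin D) ℂ) {n : ℕ} (ψ : NBody μ D n) :
    spinNBody μ M n ψ =ᵐ[Measure.pi (fun _ : Fin n => μ)]
      fun k => Matrix.toEuclideanCLM (n := Fin D) (𝕜 := ℂ) M (ψ k) :=
  ContinuousLinearMap.coeFn_compLpL _ _

theorem spinNBody_mul (M M' : Matrix (Fin D) (Fin D) ℂ) {n : ℕ} (ψ : NBody μ D n) :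
    spinNBody μ (M * M') n ψ = spinNBody μ M n (spinNBody μ M' n ψ) := by
  refine Lp.ext ?_
  filter_upwards [coeFn_spinNBody (M * M') ψ, coeFn_spinNBody M' ψ,
    coeFn_spinNBody M (spinNBody μ M' n ψ)] with k hmul hM' hM
  rw [hmul, hM, hM', map_mul]
  rfl

theorem inner_spinNBody_left (M : Matrix (Fin D) (Fin D) ℂ) {n : ℕ} (ψ φ : NBody μ D n) :
    ⟪spinNBody μ M n ψ, φ⟫_ℂ = ⟪ψ, spinNBody μ M.conjTranspose n φ⟫_ℂ := by
  rw [L2.inner_def, L2.inner_def]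
  refine integral_congr_ae ?_
  filter_upwards [coeFn_spinNBody M ψ, coeFn_spinNBody M.conjTranspose φ] with k hψ hφ
  rw [hψ, hφ, ← Matrix.star_eq_conjTranspose, map_star, ContinuousLinearMap.star_eq_adjoint,
    ContinuousLinearMap.adjoint_inner_right]

variable [SigmaFinite μ]

theorem spinNBody_permute (M : Matrix (Fin D) (Fin D) ℂ) {n : ℕ} (σ : Equiv.Perm (Fin n))
    (ψ : NBody μ D n) :
    spinNBody μ M n (permute μ D σ ψ) = permute μ D σ (spinNBody μ M n ψ) := by
  refine Lp.ext ?_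
  filter_upwards [coeFn_spinNBody M (permute μ D σ ψ), coeFn_permute σ ψ,
    coeFn_permute σ (spinNBody μ M n ψ),
    (measurePreserving_perm μ σ).quasiMeasurePreserving.ae (coeFn_spinNBody M ψ)]
    with k hMperm hperm hpermM hM
  rw [hMperm, hperm, hpermM, hM]

theorem spinNBody_average (M : Matrix (Fin D) (Fin D) ℂ) {n : ℕ} (ψ : NBody μ D n) :
    spinNBody μ M n (average μ D n ψ) = average μ D n (spinNBody μ M n ψ) := by
  simp only [average_apply, map_smul, map_sum, spinNBody_permute]

theorem spinNBody_tensor (M : Matrix (Fin D) (Fin D) ℂ) {n : ℕ} (f : Lp ℂ 2 μ)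
    (ψ : NBody μ D n) :
    spinNBody μ M (n + 1) (tensor f ψ) = tensor f (spinNBody μ M n ψ) := by
  refine Lp.ext ?_
  filter_upwards [coeFn_spinNBody M (tensor f ψ), coeFn_tensor f ψ,
    coeFn_tensor f (spinNBody μ M n ψ), ae_tail (coeFn_spinNBody M ψ)] with
    k hMtensor htensor htensorM hM
  rw [hMtensor, htensor, htensorM, hM, map_smul]

theorem coe_spinSector (M : Matrix (Fin D) (Fin D) ℂ) {n : ℕ} (ψ : Sector μ D n) :
    (spinSector μ M n ψ : NBody μ D n) = spinNBody μ M n ψ := rfl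

theorem spinSector_mul (M M' : Matrix (Fin D) (Fin D) ℂ) {n : ℕ} (ψ : Sector μ D n) :
    spinSector μ (M * M') n ψ = spinSector μ M n (spinSector μ M' n ψ) :=
  Subtype.ext (spinNBody_mul M M' _)

theorem inner_spinSector_left (M : Matrix (Fin D) (Fin D) ℂ) {n : ℕ} (ψ φ : Sector μ D n) :
    ⟪spinSector μ M n ψ, φ⟫_ℂ = ⟪ψ, spinSector μ M.conjTranspose n φ⟫_ℂ :=
  inner_spinNBody_left M _ _

theorem spinSector_createSector (M : Matrix (Fin D) (Fin D) ℂ) (f : Lp ℂ 2 μ) {n : ℕ}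
    (ψ : Sector μ D n) :
    spinSector μ M (n + 1) (createSector D f n ψ) = createSector D f n (spinSector μ M n ψ) := by
  refine Subtype.ext ?_
  rw [coe_spinSector, coe_createSector, coe_createSector, coe_spinSector, map_smul,
    spinNBody_average, spinNBody_tensor]

theorem spinSector_annihilateSector (M : Matrix (Fin D) (Fin D) ℂ) (f : Lp ℂ 2 μ) {n : ℕ}
    (ψ : Sector μ D (n + 1)) :
    spinSector μ M n (annihilateSector D f n ψ) =
      annihilateSector D f n (spinSector μ M (n + 1) ψ) := by
  refine ext_inner_left ℂ fun χ => ?_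
  have h : ∀ {n : ℕ} (χ ψ : Sector μ D n), ⟪χ, spinSector μ M n ψ⟫_ℂ =
      ⟪spinSector μ M.conjTranspose n χ, ψ⟫_ℂ := fun χ ψ => by
    rw [inner_spinSector_left, Matrix.conjTranspose_conjTranspose]
  rw [h, annihilateSector, ContinuousLinearMap.adjoint_inner_right,
    ContinuousLinearMap.adjoint_inner_right, h, spinSector_createSector]

theorem spinSector_vacuum_zero (M : Matrix (Fin D) (Fin D) ℂ) (v : EuclideanSpace ℂ (Fin D)) :
    spinSector μ M 0 (vacuum μ v 0) =
      vacuum μ (Matrix.toEuclideanCLM (n := Fin D) (𝕜 := ℂ) M v) 0 := by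
  refine Subtype.ext (Lp.ext ?_)
  filter_upwards [coeFn_spinNBody M (vacuum μ v 0 : NBody μ D 0), coeFn_vacuum_zero (μ := μ) v,
    coeFn_vacuum_zero (μ := μ) (Matrix.toEuclideanCLM (n := Fin D) (𝕜 := ℂ) M v)] with k hM hv hMv
  rw [coe_spinSector, hM, hv, hMv]

end SpinSector

section FormalAlgebra

variable {X : Type*} [MeasurableSpace X] {μ : Measure X} [SigmaFinite μ] {D N : ℕ}

theorem createFormal_zero (f : Lp ℂ 2 μ) (Ψ : FormalFock μ D) : createFormal D f Ψ 0 = 0 := rfl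

theorem createFormal_succ (f : Lp ℂ 2 μ) (Ψ : FormalFock μ D) (n : ℕ) :
    createFormal D f Ψ (n + 1) = createSector D f n (Ψ n) := rfl

theorem annihilateFormal_apply (f : Lp ℂ 2 μ) (Ψ : FormalFock μ D) (n : ℕ) :
    annihilateFormal D f Ψ n = annihilateSector D f n (Ψ (n + 1)) := rfl

theorem spinFormal_apply (M : Matrix (Fin D) (Fin D) ℂ) (Ψ : FormalFock μ D) (n : ℕ) :
    spinFormal μ M Ψ n = spinSector μ M n (Ψ n) := rfl

theorem commute_createFormal (f g : Lp ℂ 2 μ) :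
    Commute (createFormal D f) (createFormal D g) := by
  refine LinearMap.ext fun Ψ => funext fun n => ?_
  simp only [Module.End.mul_apply]
  rcases n with _ | _ | n
  · rfl
  · simp only [createFormal_succ, createFormal_zero, map_zero]
  · simp only [createFormal_succ, createSector_comm f g]

theorem annihilateFormal_createFormal (h f : Lp ℂ 2 μ) (Ψ : FormalFock μ D) :
    annihilateFormal D h (createFormal D f Ψ) =
      createFormal D f (annihilateFormal D h Ψ) + ⟪h, f⟫_ℂ • Ψ := by
  funext n
  rw [Pi.add_apply, Pi.smul_apply]
  cases n with
  | zero =>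
    rw [annihilateFormal_apply, createFormal_succ, createFormal_zero,
      annihilateSector_createSector_zero, zero_add]
  | succ n =>
    rw [annihilateFormal_apply, createFormal_succ, createFormal_succ, annihilateFormal_apply,
      annihilateSector_createSector_succ]

theorem commute_spinFormal_createFormal (M : Matrix (Fin D) (Fin D) ℂ) (f : Lp ℂ 2 μ) :
    Commute (spinFormal μ M) (createFormal D f) := by
  refine LinearMap.ext fun Ψ => funext fun n => ?_
  cases n with
  | zero => exact map_zero (spinSector μ M 0)
  | succ n => exact spinSector_createSector M f (Ψ n)

theorem commute_spinFormal_annihilateFormal (M : Matrix (Fin D) (Fin D) ℂ) (f : Lp ℂ 2 μ) :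
    Commute (spinFormal μ M) (annihilateFormal D f) :=
  LinearMap.ext fun Ψ => funext fun n => spinSector_annihilateSector M f (Ψ (n + 1))

theorem commute_spinFormal {M M' : Matrix (Fin D) (Fin D) ℂ} (h : Commute M M') :
    Commute (spinFormal μ M) (spinFormal μ M') := by
  refine LinearMap.ext fun Ψ => funext fun n => ?_
  simp only [Module.End.mul_apply, spinFormal_apply, ← spinSector_mul, h.eq]

theorem dressingGenerator_apply (B : Fin N → Matrix (Fin D) (Fin D) ℂ) (g : Fin N → Lp ℂ 2 μ)
    (Ψ : FormalFock μ D) :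
    dressingGenerator B g Ψ = -∑ j, spinFormal μ (B j) (createFormal D (g j) Ψ) := by
  simp [dressingGenerator]

theorem dressingGenerator_zero (B : Fin N → Matrix (Fin D) (Fin D) ℂ) (g : Fin N → Lp ℂ 2 μ)
    (Ψ : FormalFock μ D) : dressingGenerator B g Ψ 0 = 0 := by
  simp [dressingGenerator_apply, spinFormal_apply, createFormal_zero]

theorem dressingGenerator_succ (B : Fin N → Matrix (Fin D) (Fin D) ℂ) (g : Fin N → Lp ℂ 2 μ)
    (Ψ : FormalFock μ D) (n : ℕ) :
    dressingGenerator B g Ψ (n + 1) =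
      -∑ j, spinSector μ (B j) (n + 1) (createSector D (g j) n (Ψ n)) := by
  simp [dressingGenerator_apply, spinFormal_apply, createFormal_succ]

theorem commute_spinFormal_dressingGenerator {B : Fin N → Matrix (Fin D) (Fin D) ℂ}
    {M : Matrix (Fin D) (Fin D) ℂ} (hM : ∀ j, Commute M (B j)) (g : Fin N → Lp ℂ 2 μ) :
    Commute (spinFormal μ M) (dressingGenerator B g) :=
  (Commute.sum_right _ _ _ fun j _ =>
    (commute_spinFormal (hM j)).mul_right (commute_spinFormal_createFormal M (g j))).neg_right

/-- The shift `∑ⱼ ⟨h, gⱼ⟩ Bⱼ` of the displaced annihilation operator. -/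
def shiftFormal (B : Fin N → Matrix (Fin D) (Fin D) ℂ) (g : Fin N → Lp ℂ 2 μ) (h : Lp ℂ 2 μ) :
    FormalFock μ D →ₗ[ℂ] FormalFock μ D :=
  ∑ j, ⟪h, g j⟫_ℂ • spinFormal μ (B j)

theorem shiftFormal_apply (B : Fin N → Matrix (Fin D) (Fin D) ℂ) (g : Fin N → Lp ℂ 2 μ)
    (h : Lp ℂ 2 μ) (Ψ : FormalFock μ D) :
    shiftFormal B g h Ψ = ∑ j, ⟪h, g j⟫_ℂ • spinFormal μ (B j) Ψ := by
  simp [shiftFormal]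

theorem commute_shiftFormal_createFormal (B : Fin N → Matrix (Fin D) (Fin D) ℂ)
    (g : Fin N → Lp ℂ 2 μ) (h f : Lp ℂ 2 μ) :
    Commute (shiftFormal B g h) (createFormal D f) :=
  Commute.sum_left _ _ _ fun j _ => (commute_spinFormal_createFormal (B j) f).smul_left _

theorem commute_shiftFormal_dressingGenerator {B : Fin N → Matrix (Fin D) (Fin D) ℂ}
    (hB : ∀ j j', Commute (B j) (B j')) (g : Fin N → Lp ℂ 2 μ) (h : Lp ℂ 2 μ) :
    Commute (shiftFormal B g h) (dressingGenerator B g) :=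
  Commute.sum_left _ _ _ fun j _ => (commute_spinFormal_dressingGenerator (hB j) g).smul_left _

theorem annihilateFormal_dressingGenerator (B : Fin N → Matrix (Fin D) (Fin D) ℂ)
    (g : Fin N → Lp ℂ 2 μ) (h : Lp ℂ 2 μ) (Ψ : FormalFock μ D) :
    annihilateFormal D h (dressingGenerator B g Ψ) =
      dressingGenerator B g (annihilateFormal D h Ψ) - shiftFormal B g h Ψ := by
  have hspin (j : Fin N) (Φ : FormalFock μ D) : annihilateFormal D h (spinFormal μ (B j) Φ) =
      spinFormal μ (B j) (annihilateFormal D h Φ) :=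
    (DFunLike.congr_fun (commute_spinFormal_annihilateFormal (B j) h).eq Φ).symm
  simp only [dressingGenerator_apply, shiftFormal_apply, map_neg, map_sum, hspin,
    annihilateFormal_createFormal, map_add, map_smul, Finset.sum_add_distrib]
  abel

variable (D) in
/-- The product `a*(h₁) ⋯ a*(hₙ)` on sequences of components. -/
def createProd (hs : List (Lp ℂ 2 μ)) : FormalFock μ D →ₗ[ℂ] FormalFock μ D :=
  (hs.map (createFormal D)).prod

theorem createProd_nil (Ψ : FormalFock μ D) : createProd D [] Ψ = Ψ := rfl

theorem createProd_cons (h : Lp ℂ 2 μ) (hs : List (Lp ℂ 2 μ)) (Ψ : FormalFock μ D) :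
    createProd D (h :: hs) Ψ = createFormal D h (createProd D hs Ψ) := by
  simp [createProd]

theorem createProd_append_singleton (hs : List (Lp ℂ 2 μ)) (h : Lp ℂ 2 μ) (Ψ : FormalFock μ D) :
    createProd D (hs ++ [h]) Ψ = createProd D hs (createFormal D h Ψ) := by
  simp [createProd]

end FormalAlgebra

section NumberOperator

variable {X : Type*} [MeasurableSpace X] {μ : Measure X} [SigmaFinite μ] {D N : ℕ}

variable (μ D) in
/-- The number operator `(𝒩 Ψ)⁽ⁿ⁾ = n Ψ⁽ⁿ⁾` on sequences of components. -/
def numberFormal : FormalFock μ D →ₗ[ℂ] FormalFock μ D :=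
  LinearMap.pi fun n => (n : ℂ) • LinearMap.proj n

theorem numberFormal_apply (Ψ : FormalFock μ D) (n : ℕ) :
    numberFormal μ D Ψ n = (n : ℂ) • Ψ n := rfl

theorem numberFormal_createFormal (f : Lp ℂ 2 μ) (Ψ : FormalFock μ D) :
    numberFormal μ D (createFormal D f Ψ) =
      createFormal D f (numberFormal μ D Ψ) + createFormal D f Ψ := by
  funext n
  cases n with
  | zero => simp [numberFormal_apply, createFormal_zero]
  | succ n =>
    simp only [Pi.add_apply, numberFormal_apply, createFormal_succ, map_smul, Nat.cast_succ,
      add_smul, one_smul]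

theorem numberFormal_createProd (hs : List (Lp ℂ 2 μ)) (Ψ : FormalFock μ D) :
    numberFormal μ D (createProd D hs Ψ) =
      createProd D hs (numberFormal μ D Ψ) + (hs.length : ℂ) • createProd D hs Ψ := by
  induction hs with
  | nil => simp [createProd_nil]
  | cons h hs ih =>
    rw [createProd_cons, numberFormal_createFormal, ih, map_add, map_smul, createProd_cons,
      List.length_cons, Nat.cast_succ]
    module

theorem dressingGenerator_pow_vacuum_of_lt (B : Fin N → Matrix (Fin D) (Fin D) ℂ)
    (g : Fin N → Lp ℂ 2 μ) (v : EuclideanSpace ℂ (Fin D)) {n m : ℕ} (h : n < m) :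
    (dressingGenerator B g ^ n) (fun k => vacuum μ v k) m = 0 := by
  induction n generalizing m with
  | zero => exact lp.single_apply_ne 2 _ _ h.ne'
  | succ n ih =>
    obtain ⟨m, rfl⟩ := Nat.exists_eq_add_one.2 (Nat.zero_lt_of_lt h)
    rw [pow_succ', Module.End.mul_apply, dressingGenerator_succ, ih (Nat.lt_of_succ_lt_succ h)]
    simp

/-- The sequence of components of `T (v ⊗ Ω)`. -/
def dressedVacuum (B : Fin N → Matrix (Fin D) (Fin D) ℂ) (g : Fin N → Lp ℂ 2 μ)
    (v : EuclideanSpace ℂ (Fin D)) : FormalFock μ D :=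
  dressingFormal B g (fun n => vacuum μ v n)

theorem dressedVacuum_apply (B : Fin N → Matrix (Fin D) (Fin D) ℂ) (g : Fin N → Lp ℂ 2 μ)
    (v : EuclideanSpace ℂ (Fin D)) (m : ℕ) :
    dressedVacuum B g v m =
      ((m.factorial : ℂ)⁻¹) • (dressingGenerator B g ^ m) (fun n => vacuum μ v n) m := by
  refine (hasSum_dressingFormal B g _ m).unique (hasSum_single m fun n hn => ?_)
  rcases hn.lt_or_gt with hn | hn
  · rw [dressingGenerator_pow_vacuum_of_lt B g v hn, smul_zero]
  · rw [dressingGenerator_pow_apply_eq_zero B g _ n m hn, smul_zero]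

theorem dressedVacuum_zero (B : Fin N → Matrix (Fin D) (Fin D) ℂ) (g : Fin N → Lp ℂ 2 μ)
    (v : EuclideanSpace ℂ (Fin D)) : dressedVacuum B g v 0 = vacuum μ v 0 := by
  simp [dressedVacuum_apply]

theorem numberFormal_dressedVacuum (B : Fin N → Matrix (Fin D) (Fin D) ℂ) (g : Fin N → Lp ℂ 2 μ)
    (v : EuclideanSpace ℂ (Fin D)) :
    numberFormal μ D (dressedVacuum B g v) = dressingGenerator B g (dressedVacuum B g v) := by
  funext m
  cases m with
  | zero => simp [numberFormal_apply, dressingGenerator_zero]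
  | succ m =>
    have hm : ((m + 1 : ℕ) : ℂ) * (((m + 1).factorial : ℕ) : ℂ)⁻¹ = ((m.factorial : ℕ) : ℂ)⁻¹ := by
      rw [Nat.factorial_succ, Nat.cast_mul, mul_inv,
        mul_inv_cancel_left₀ (by exact_mod_cast m.succ_ne_zero)]
    rw [numberFormal_apply, dressedVacuum_apply, smul_smul, hm, pow_succ', Module.End.mul_apply,
      dressingGenerator_succ, dressingGenerator_succ, dressedVacuum_apply]
    simp only [map_smul, smul_neg, Finset.smul_sum]

theorem eq_zero_of_numberFormal_add_smul_eq {B : Fin N → Matrix (Fin D) (Fin D) ℂ}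
    {g : Fin N → Lp ℂ 2 μ} {Ψ : FormalFock μ D} (c : ℕ)
    (hΨ : numberFormal μ D Ψ + (c : ℂ) • Ψ = dressingGenerator B g Ψ) (hvacuum : Ψ 0 = 0) :
    Ψ = 0 := by
  funext n
  induction n with
  | zero => exact hvacuum
  | succ n ih =>
    have hn : ((n + 1 + c : ℕ) : ℂ) ≠ 0 := by exact_mod_cast (by omega : n + 1 + c ≠ 0)
    have hΨn := congrFun hΨ (n + 1)
    rw [dressingGenerator_succ, ih, Pi.add_apply, Pi.smul_apply, numberFormal_apply, ← add_smul,
      ← Nat.cast_add] at hΨn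
    refine (smul_eq_zero.1 (hΨn.trans ?_)).resolve_left hn
    simp

theorem commute_numberFormal_spinFormal (M : Matrix (Fin D) (Fin D) ℂ) :
    Commute (numberFormal μ D) (spinFormal μ M) :=
  LinearMap.ext fun _ => funext fun n => (map_smul (spinSector μ M n) _ _).symm

theorem commute_numberFormal_shiftFormal (B : Fin N → Matrix (Fin D) (Fin D) ℂ)
    (g : Fin N → Lp ℂ 2 μ) (h : Lp ℂ 2 μ) :
    Commute (numberFormal μ D) (shiftFormal B g h) :=
  Commute.sum_right _ _ _ fun j _ => (commute_numberFormal_spinFormal (B j)).smul_right _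

theorem spinFormal_dressedVacuum {B : Fin N → Matrix (Fin D) (Fin D) ℂ}
    {M : Matrix (Fin D) (Fin D) ℂ} (hM : ∀ j, Commute M (B j)) (g : Fin N → Lp ℂ 2 μ)
    (v : EuclideanSpace ℂ (Fin D)) :
    spinFormal μ M (dressedVacuum B g v) =
      dressedVacuum B g (Matrix.toEuclideanCLM (n := Fin D) (𝕜 := ℂ) M v) := by
  refine sub_eq_zero.1 (eq_zero_of_numberFormal_add_smul_eq (B := B) (g := g) 0 ?_ ?_)
  · have hN := DFunLike.congr_fun (commute_numberFormal_spinFormal M).eq (dressedVacuum B g v)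
    have hG := DFunLike.congr_fun (commute_spinFormal_dressingGenerator hM g).eq
      (dressedVacuum B g v)
    simp only [Module.End.mul_apply, numberFormal_dressedVacuum] at hN hG
    rw [Nat.cast_zero, zero_smul, add_zero, map_sub, map_sub, hN, hG, numberFormal_dressedVacuum]
  · rw [Pi.sub_apply, spinFormal_apply, dressedVacuum_zero, dressedVacuum_zero,
      spinSector_vacuum_zero, sub_self]

theorem annihilateFormal_numberFormal (h : Lp ℂ 2 μ) (Ψ : FormalFock μ D) :
    annihilateFormal D h (numberFormal μ D Ψ) =
      numberFormal μ D (annihilateFormal D h Ψ) + annihilateFormal D h Ψ := by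
  funext n
  simp only [Pi.add_apply, numberFormal_apply, annihilateFormal_apply, map_smul, map_add,
    Nat.cast_succ, add_smul, one_smul]

/-- The displaced annihilation operator `â(h)` on sequences of components. -/
def displacedFormal (B : Fin N → Matrix (Fin D) (Fin D) ℂ) (g : Fin N → Lp ℂ 2 μ)
    (h : Lp ℂ 2 μ) : FormalFock μ D →ₗ[ℂ] FormalFock μ D :=
  annihilateFormal D h + shiftFormal B g h

theorem displacedFormal_createFormal (B : Fin N → Matrix (Fin D) (Fin D) ℂ)
    (g : Fin N → Lp ℂ 2 μ) (h f : Lp ℂ 2 μ) (Ψ : FormalFock μ D) :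
    displacedFormal B g h (createFormal D f Ψ) =
      createFormal D f (displacedFormal B g h Ψ) + ⟪h, f⟫_ℂ • Ψ := by
  have hshift := DFunLike.congr_fun (commute_shiftFormal_createFormal B g h f).eq Ψ
  simp only [Module.End.mul_apply] at hshift
  rw [displacedFormal, LinearMap.add_apply, LinearMap.add_apply, annihilateFormal_createFormal,
    hshift, map_add]
  abel

theorem displacedFormal_dressedVacuum {B : Fin N → Matrix (Fin D) (Fin D) ℂ}
    (hB : ∀ j j', Commute (B j) (B j')) (g : Fin N → Lp ℂ 2 μ) (h : Lp ℂ 2 μ)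
    (v : EuclideanSpace ℂ (Fin D)) :
    displacedFormal B g h (dressedVacuum B g v) = 0 := by
  set T := dressedVacuum B g v
  have hannihilate : numberFormal μ D (annihilateFormal D h T) + annihilateFormal D h T =
      dressingGenerator B g (annihilateFormal D h T) - shiftFormal B g h T := by
    rw [← annihilateFormal_numberFormal, numberFormal_dressedVacuum,
      annihilateFormal_dressingGenerator]
  have hshift : numberFormal μ D (shiftFormal B g h T) =
      dressingGenerator B g (shiftFormal B g h T) := by
    have hN := DFunLike.congr_fun (commute_numberFormal_shiftFormal B g h).eq T
    have hG := DFunLike.congr_fun (commute_shiftFormal_dressingGenerator hB g h).eq T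
    simp only [Module.End.mul_apply] at hN hG
    rw [hN, numberFormal_dressedVacuum, hG]
  have hdisplaced :
      numberFormal μ D (displacedFormal B g h T) + ((1 : ℕ) : ℂ) • displacedFormal B g h T =
      dressingGenerator B g (displacedFormal B g h T) := by
    rw [displacedFormal, LinearMap.add_apply, map_add, map_add, Nat.cast_one]
    linear_combination (norm := module) hannihilate + hshift
  refine eq_zero_of_numberFormal_add_smul_eq 1 hdisplaced ?_
  have hvacuum := congrFun hdisplaced 0
  simpa [numberFormal_apply, dressingGenerator_zero] using hvacuum

end NumberOperator

section Moments

open NormedSpace Nat in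
theorem hasSum_exp_mul_eq_zero {d : ℕ → ℂ} (hd : ∀ r : ℕ, Summable fun n => (r : ℝ) ^ n * ‖d n‖)
    (hmoments : ∀ k : ℕ, HasSum (fun n : ℕ => (n : ℂ) ^ k * d n) 0) (z : ℂ) :
    HasSum (fun n : ℕ => Complex.exp z ^ n * d n) 0 := by
  let F : ℕ × ℕ → ℂ := fun p => (p.1 * z) ^ p.2 / (p.2 !) * d p.1
  have hrow (n : ℕ) : HasSum (fun k => F (n, k)) (Complex.exp z ^ n * d n) := by
    rw [← Complex.exp_nat_mul, Complex.exp_eq_exp_ℂ]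
    exact (expSeries_div_hasSum_exp (n * z)).mul_right (d n)
  have hcol (k : ℕ) : HasSum (fun n => F (n, k)) 0 := by
    have hscaled := (hmoments k).mul_left (z ^ k / k !)
    rw [mul_zero] at hscaled
    refine hscaled.congr_fun fun n => ?_
    simp only [F]
    ring
  have hnorm (n : ℕ) : HasSum (fun k => ‖F (n, k)‖) (Real.exp ‖z‖ ^ n * ‖d n‖) := by
    rw [← Real.exp_nat_mul, Real.exp_eq_exp_ℝ]
    simpa only [F, norm_mul, norm_div, norm_pow, Complex.norm_natCast]
      using (expSeries_div_hasSum_exp (n * ‖z‖)).mul_right ‖d n‖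
  have hF : Summable F := by
    refine Summable.of_norm ((summable_prod_of_nonneg fun p => norm_nonneg (F p)).2
      ⟨fun n => (hnorm n).summable, ?_⟩)
    simp only [(hnorm _).tsum_eq]
    refine Summable.of_nonneg_of_le (fun n => by positivity) (fun n => ?_) (hd ⌈Real.exp ‖z‖⌉₊)
    gcongr
    exact Nat.le_ceil _
  have hzero : HasSum F 0 := by
    have hswap := ((Equiv.prodComm ℕ ℕ).hasSum_iff.2 hF.hasSum).prod_fiberwise hcol
    exact hswap.unique hasSum_zero ▸ hF.hasSum
  exact hzero.prod_fiberwise hrow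

theorem eq_zero_of_hasSum_pow_mul_eq_zero {d : ℕ → ℂ} (hd : Summable fun n => ‖d n‖)
    (h : ∀ w : ℂ, w ≠ 0 → HasSum (fun n : ℕ => w ^ n * d n) 0) : d = 0 := by
  by_contra hne
  let p := FormalMultilinearSeries.ofScalars ℂ d
  have hradius : 0 < p.radius := by
    refine one_pos.trans_le (p.le_radius_of_summable (r := 1) ?_)
    simpa [p, FormalMultilinearSeries.ofScalars_norm] using hd
  have hp : p ≠ 0 := by rwa [Ne, FormalMultilinearSeries.ofScalars_series_eq_zero]
  obtain ⟨w, hw, hw0⟩ := (((p.hasFPowerSeriesOnBall hradius).hasFPowerSeriesAt.locally_ne_zero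
    hp).and self_mem_nhdsWithin).exists
  refine hw ?_
  rw [← (h w hw0).tsum_eq]
  refine (FormalMultilinearSeries.ofScalars_sum_eq d w).trans ?_
  simp only [smul_eq_mul, mul_comm]

theorem eq_zero_of_hasSum_moments_eq_zero {d : ℕ → ℂ}
    (hd : ∀ r : ℕ, Summable fun n => (r : ℝ) ^ n * ‖d n‖)
    (hmoments : ∀ k : ℕ, HasSum (fun n : ℕ => (n : ℂ) ^ k * d n) 0) : d = 0 :=
  eq_zero_of_hasSum_pow_mul_eq_zero (by simpa using hd 1) fun w hw => by
    simpa only [Complex.exp_log hw] using hasSum_exp_mul_eq_zero hd hmoments (Complex.log w)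

end Moments

section Rapid

variable {X : Type*} [MeasurableSpace X] {μ : Measure X} [SigmaFinite μ] {D N : ℕ}

variable (μ D) in
/-- The sequences of components that decay faster than any exponential in the boson number. -/
def rapid : Submodule ℂ (FormalFock μ D) where
  carrier := {Ψ | ∀ r : ℕ, Summable fun n => (r : ℝ) ^ n * ‖Ψ n‖}
  zero_mem' r := by simp
  add_mem' {Ψ Φ} hΨ hΦ r := by
    refine Summable.of_nonneg_of_le (fun n => by positivity) (fun n => ?_) ((hΨ r).add (hΦ r))
    rw [← mul_add]
    gcongr
    exact norm_add_le _ _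
  smul_mem' c Ψ hΨ r := by
    simpa only [Pi.smul_apply, norm_smul, mul_left_comm] using (hΨ r).mul_left ‖c‖

theorem summable_pow_mul_norm_sq_of_mem_rapid {Ψ : FormalFock μ D} (hΨ : Ψ ∈ rapid μ D) (r : ℕ) :
    Summable fun n => (r : ℝ) ^ n * ‖Ψ n‖ ^ 2 := by
  have hlim : Tendsto (fun n => ‖Ψ n‖) atTop (𝓝 0) := by
    simpa using (hΨ 1).tendsto_atTop_zero
  refine (hΨ r).of_norm_bounded_eventually_nat ?_
  filter_upwards [hlim.eventually_le_const one_pos] with n hn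
  rw [Real.norm_of_nonneg (by positivity), sq]
  gcongr
  exact mul_le_of_le_one_left (norm_nonneg _) hn

theorem memℓp_of_mem_rapid {Ψ : FormalFock μ D} (hΨ : Ψ ∈ rapid μ D) : Memℓp Ψ 2 :=
  memℓp_two (by simpa using summable_pow_mul_norm_sq_of_mem_rapid hΨ 1)

theorem mem_numberHalfDomain_of_mem_rapid {Ψ : Fock μ D} (hΨ : (fun n => Ψ n) ∈ rapid μ D) :
    Ψ ∈ numberHalfDomain μ D := by
  refine Summable.of_nonneg_of_le (fun n => by positivity) (fun n => ?_)
    (summable_pow_mul_norm_sq_of_mem_rapid hΨ 2)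
  gcongr
  exact_mod_cast n.lt_two_pow_self.le

theorem norm_createFormal_succ_le (f : Lp ℂ 2 μ) (Ψ : FormalFock μ D) (n : ℕ) :
    ‖createFormal D f Ψ (n + 1)‖ ≤ Real.sqrt (n + 1) * ‖f‖ * ‖Ψ n‖ :=
  (createSector D f n).le_of_opNorm_le (norm_createSector_le f n) _

theorem createFormal_mem_rapid (f : Lp ℂ 2 μ) {Ψ : FormalFock μ D} (hΨ : Ψ ∈ rapid μ D) :
    createFormal D f Ψ ∈ rapid μ D := by
  refine fun r => (summable_nat_add_iff 1).1 ?_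
  refine Summable.of_nonneg_of_le (fun n => by positivity) (fun n => ?_)
    ((hΨ (r * 2)).mul_left (r * ‖f‖))
  have hsqrt : Real.sqrt (n + 1) ≤ 2 ^ n := by
    refine Real.sqrt_le_left (by positivity) |>.2 ?_
    have : (n + 1 : ℝ) ≤ 2 ^ n := by exact_mod_cast n.lt_two_pow_self
    nlinarith [one_le_pow₀ (one_le_two (α := ℝ)) (n := n)]
  calc (r : ℝ) ^ (n + 1) * ‖createFormal D f Ψ (n + 1)‖
      ≤ (r : ℝ) ^ (n + 1) * (2 ^ n * ‖f‖ * ‖Ψ n‖) := by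
        gcongr
        exact (norm_createFormal_succ_le f Ψ n).trans (by gcongr)
    _ = r * ‖f‖ * (((r * 2 : ℕ) : ℝ) ^ n * ‖Ψ n‖) := by
        push_cast
        ring

theorem createProd_mem_rapid (hs : List (Lp ℂ 2 μ)) {Ψ : FormalFock μ D} (hΨ : Ψ ∈ rapid μ D) :
    createProd D hs Ψ ∈ rapid μ D := by
  induction hs with
  | nil => exact hΨ
  | cons h hs ih =>
    rw [createProd_cons]
    exact createFormal_mem_rapid h ih

theorem norm_dressingGenerator_succ_le (B : Fin N → Matrix (Fin D) (Fin D) ℂ)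
    (g : Fin N → Lp ℂ 2 μ) (Ψ : FormalFock μ D) (n : ℕ) :
    ‖dressingGenerator B g Ψ (n + 1)‖ ≤
      (∑ j, ‖Matrix.toEuclideanCLM (n := Fin D) (𝕜 := ℂ) (B j)‖ * ‖g j‖) *
        Real.sqrt (n + 1) * ‖Ψ n‖ := by
  rw [dressingGenerator_succ, norm_neg, Finset.sum_mul, Finset.sum_mul]
  refine norm_sum_le_of_le _ fun j _ => ?_
  calc _ ≤ ‖Matrix.toEuclideanCLM (n := Fin D) (𝕜 := ℂ) (B j)‖ * ‖createSector D (g j) n (Ψ n)‖ :=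
        (spinSector μ (B j) (n + 1)).le_of_opNorm_le (norm_spinSector_le _ _) _
    _ ≤ ‖Matrix.toEuclideanCLM (n := Fin D) (𝕜 := ℂ) (B j)‖ *
          (Real.sqrt (n + 1) * ‖g j‖ * ‖Ψ n‖) := by
        gcongr
        exact norm_createFormal_succ_le (g j) Ψ n
    _ = _ := by ring

theorem dressedVacuum_mem_rapid (B : Fin N → Matrix (Fin D) (Fin D) ℂ) (g : Fin N → Lp ℂ 2 μ)
    (v : EuclideanSpace ℂ (Fin D)) : dressedVacuum B g v ∈ rapid μ D := by
  intro r
  set c := ∑ j, ‖Matrix.toEuclideanCLM (n := Fin D) (𝕜 := ℂ) (B j)‖ * ‖g j‖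
  -- By `𝒩 T v = G T v`, the norms of consecutive components have ratio at most `c / √(n + 1)`.
  have hratio (n : ℕ) : Real.sqrt (n + 1) * ‖dressedVacuum B g v (n + 1)‖ ≤
      c * ‖dressedVacuum B g v n‖ := by
    have hN := congrFun (numberFormal_dressedVacuum B g v) (n + 1)
    have hG := norm_dressingGenerator_succ_le B g (dressedVacuum B g v) n
    rw [← hN, numberFormal_apply, norm_smul, Complex.norm_natCast, Nat.cast_succ,
      mul_right_comm] at hG
    refine le_of_mul_le_mul_right (le_of_eq_of_le ?_ hG) (Real.sqrt_pos.2 n.cast_add_one_pos)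
    rw [mul_right_comm, Real.mul_self_sqrt n.cast_add_one_pos.le]
  have hlim : Tendsto (fun n : ℕ => Real.sqrt (n + 1)) atTop atTop :=
    Real.tendsto_sqrt_atTop.comp (tendsto_atTop_add_const_right _ 1 tendsto_natCast_atTop_atTop)
  refine summable_of_ratio_norm_eventually_le one_half_lt_one ?_
  filter_upwards [hlim.eventually_ge_atTop (2 * r * c)] with n hn
  simp only [norm_mul, norm_pow, norm_norm, Real.norm_natCast]
  have hpos : 0 < Real.sqrt (n + 1) := Real.sqrt_pos.2 n.cast_add_one_pos
  refine le_of_mul_le_mul_left ?_ hpos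
  calc Real.sqrt (n + 1) * ((r : ℝ) ^ (n + 1) * ‖dressedVacuum B g v (n + 1)‖)
      = (r : ℝ) ^ (n + 1) * (Real.sqrt (n + 1) * ‖dressedVacuum B g v (n + 1)‖) := by ring
    _ ≤ (r : ℝ) ^ (n + 1) * (c * ‖dressedVacuum B g v n‖) :=
        mul_le_mul_of_nonneg_left (hratio n) (by positivity)
    _ = 2 * r * c * (1 / 2 * ((r : ℝ) ^ n * ‖dressedVacuum B g v n‖)) := by ring
    _ ≤ Real.sqrt (n + 1) * (1 / 2 * ((r : ℝ) ^ n * ‖dressedVacuum B g v n‖)) := by gcongr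

end Rapid

section TestVectors

variable {X : Type*} [MeasurableSpace X] {μ : Measure X} [SigmaFinite μ] {D N : ℕ}

theorem mem_graph_ofFormal {A : FormalFock μ D →ₗ[ℂ] FormalFock μ D} {V : Submodule ℂ (Fock μ D)}
    {h : ∀ Ψ ∈ V, Memℓp (A (fun n => Ψ n)) 2} {Φ Ψ : Fock μ D} :
    (Φ, Ψ) ∈ (ofFormal A V h).graph ↔ Φ ∈ V ∧ (fun n => Ψ n) = A (fun n => Φ n) := by
  rw [LinearPMap.mem_graph_iff]
  constructor
  · rintro ⟨Φ', rfl, rfl⟩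
    exact ⟨Φ'.2, rfl⟩
  · rintro ⟨hΦ, hΨ⟩
    exact ⟨⟨Φ, hΦ⟩, rfl, Subtype.ext hΨ.symm⟩

theorem vacuum_mem_dressing_domain (B : Fin N → Matrix (Fin D) (Fin D) ℂ) (g : Fin N → Lp ℂ 2 μ)
    (v : EuclideanSpace ℂ (Fin D)) : vacuum μ v ∈ (dressing B g).domain :=
  memℓp_of_mem_rapid (dressedVacuum_mem_rapid B g v)

theorem isDressed_iff (B : Fin N → Matrix (Fin D) (Fin D) ℂ) (g : Fin N → Lp ℂ 2 μ) {ι : Type*}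
    (e : ι → Lp ℂ 2 μ) (v : EuclideanSpace ℂ (Fin D)) (ls : List ι) (Ψ : Fock μ D) :
    IsDressed B g e v ls Ψ ↔ (fun n => Ψ n) = createProd D (ls.map e) (dressedVacuum B g v) := by
  induction ls generalizing Ψ with
  | nil => exact mem_graph_ofFormal.trans (and_iff_right (vacuum_mem_dressing_domain B g v))
  | cons l ls ih =>
    have hrapid := createProd_mem_rapid (ls.map e) (dressedVacuum_mem_rapid B g v)
    simp only [IsDressed, ih, creation, mem_graph_ofFormal, List.map_cons, createProd_cons]
    constructor
    · rintro ⟨Φ, hΦ, -, hΨ⟩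
      rw [hΨ, hΦ]
    · intro hΨ
      exact ⟨⟨_, memℓp_of_mem_rapid hrapid⟩, rfl, mem_numberHalfDomain_of_mem_rapid hrapid, hΨ⟩

theorem existsUnique_isDressed (B : Fin N → Matrix (Fin D) (Fin D) ℂ) (g : Fin N → Lp ℂ 2 μ)
    {ι : Type*} (e : ι → Lp ℂ 2 μ) (v : EuclideanSpace ℂ (Fin D)) (ls : List ι) :
    ∃! Ψ, IsDressed B g e v ls Ψ := by
  simp only [isDressed_iff]
  exact ⟨⟨_, memℓp_of_mem_rapid (createProd_mem_rapid _ (dressedVacuum_mem_rapid B g v))⟩, rfl,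
    fun _ hΨ => Subtype.ext hΨ⟩

/-- The span of the vectors `a*(h₁) ⋯ a*(hₙ) T (v ⊗ Ω)` with all `hᵢ ∈ s`, on sequences of
components. -/
def dressedSpan (B : Fin N → Matrix (Fin D) (Fin D) ℂ) (g : Fin N → Lp ℂ 2 μ)
    (s : Set (Lp ℂ 2 μ)) : Submodule ℂ (FormalFock μ D) :=
  Submodule.span ℂ {Ψ | ∃ v hs, (∀ h ∈ hs, h ∈ s) ∧ createProd D hs (dressedVacuum B g v) = Ψ}

theorem createProd_mem_dressedSpan (B : Fin N → Matrix (Fin D) (Fin D) ℂ) (g : Fin N → Lp ℂ 2 μ)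
    {s : Set (Lp ℂ 2 μ)} (v : EuclideanSpace ℂ (Fin D)) {hs : List (Lp ℂ 2 μ)}
    (hhs : ∀ h ∈ hs, h ∈ s) : createProd D hs (dressedVacuum B g v) ∈ dressedSpan B g s :=
  Submodule.subset_span ⟨v, hs, hhs, rfl⟩

theorem dressedSpan_le_rapid (B : Fin N → Matrix (Fin D) (Fin D) ℂ) (g : Fin N → Lp ℂ 2 μ)
    (s : Set (Lp ℂ 2 μ)) : dressedSpan B g s ≤ rapid μ D := by
  refine Submodule.span_le.2 ?_
  rintro _ ⟨v, hs, -, rfl⟩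
  exact createProd_mem_rapid hs (dressedVacuum_mem_rapid B g v)

variable (μ D) in
/-- The linear map taking a vector of the Fock space to its sequence of components. -/
def components : Fock μ D →ₗ[ℂ] FormalFock μ D :=
  LinearMap.pi fun n => lp.evalₗ _ 2 n

theorem map_components_testDomain (B : Fin N → Matrix (Fin D) (Fin D) ℂ) (g : Fin N → Lp ℂ 2 μ)
    {ι : Type*} (e : ι → Lp ℂ 2 μ) :
    (testDomain B g e).map (components μ D) = dressedSpan B g (Set.range e) := by
  rw [testDomain, Submodule.map_span, dressedSpan]
  congr 1
  ext Ψ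
  constructor
  · rintro ⟨Φ, ⟨v, ls, hΦ⟩, rfl⟩
    exact ⟨v, ls.map e, by simp, ((isDressed_iff B g e v ls Φ).1 hΦ).symm⟩
  · rintro ⟨v, hs, hhs, rfl⟩
    obtain ⟨ls, rfl⟩ : hs ∈ Set.range (List.map e) := by rwa [Set.range_list_map]
    obtain ⟨Φ, hΦ⟩ := (existsUnique_isDressed B g e v ls).exists
    exact ⟨Φ, ⟨v, ls, hΦ⟩, (isDressed_iff B g e v ls Φ).1 hΦ⟩

theorem mem_testDomain_iff {B : Fin N → Matrix (Fin D) (Fin D) ℂ} {g : Fin N → Lp ℂ 2 μ}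
    {ι : Type*} {e : ι → Lp ℂ 2 μ} {Ψ : Fock μ D} :
    Ψ ∈ testDomain B g e ↔ (fun n => Ψ n) ∈ dressedSpan B g (Set.range e) := by
  have hinj : Function.Injective (components μ D) := fun _ _ h => Subtype.ext h
  rw [← map_components_testDomain]
  exact (hinj.mem_set_image (s := (testDomain B g e : Set (Fock μ D)))).symm

end TestVectors

section Density

variable {X : Type*} [MeasurableSpace X] {μ : Measure X} [SigmaFinite μ] {D N : ℕ}

theorem norm_sq_eq_tsum (Ψ : Fock μ D) : ‖Ψ‖ ^ 2 = ∑' n, ‖Ψ n‖ ^ 2 := by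
  simpa using lp.norm_rpow_eq_tsum (p := 2) (by norm_num) Ψ

theorem norm_creation_apply_le (f : Lp ℂ 2 μ) (Φ : numberHalfDomain μ D) :
    ‖creation D f Φ‖ ≤ Real.sqrt (∑' n : ℕ, ((n : ℝ) + 1) * ‖(Φ : Fock μ D) n‖ ^ 2) * ‖f‖ := by
  have hsummable : Summable fun n : ℕ => ((n : ℝ) + 1) * ‖(Φ : Fock μ D) n‖ ^ 2 := by
    simpa only [add_mul, one_mul] using Summable.add Φ.2 (summable_sq (Φ : Fock μ D))
  have hcomponent (n : ℕ) : ‖creation D f Φ (n + 1)‖ ^ 2 ≤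
      ((n : ℝ) + 1) * ‖(Φ : Fock μ D) n‖ ^ 2 * ‖f‖ ^ 2 := by
    refine (pow_le_pow_left₀ (norm_nonneg _) (norm_createFormal_succ_le f _ n) 2).trans_eq ?_
    rw [mul_pow, mul_pow, Real.sq_sqrt (by positivity)]
    ring
  refine le_of_sq_le_sq ?_ (by positivity)
  rw [mul_pow, Real.sq_sqrt (tsum_nonneg fun n => by positivity), norm_sq_eq_tsum,
    (summable_sq _).tsum_eq_zero_add, ← tsum_mul_right]
  have hzero : creation D f Φ 0 = 0 := rfl
  rw [hzero, norm_zero, zero_pow two_ne_zero, zero_add]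
  exact ((summable_nat_add_iff 1).2 (summable_sq (creation D f Φ))).tsum_le_tsum hcomponent
    (hsummable.mul_right _)

theorem createFormal_add (f g : Lp ℂ 2 μ) (Ψ : FormalFock μ D) :
    createFormal D (f + g) Ψ = createFormal D f Ψ + createFormal D g Ψ := by
  funext n
  cases n with
  | zero => simp [createFormal_zero]
  | succ n => simp only [Pi.add_apply, createFormal_succ, createSector_add, add_apply]

theorem createFormal_smul (c : ℂ) (f : Lp ℂ 2 μ) (Ψ : FormalFock μ D) :
    createFormal D (c • f) Ψ = c • createFormal D f Ψ := by
  funext n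
  cases n with
  | zero => simp [createFormal_zero]
  | succ n => simp only [Pi.smul_apply, createFormal_succ, createSector_smul, smul_apply]

/-- The bounded map `f ↦ a*(f) Φ`, for a fixed vector `Φ` of the domain. -/
def creationCLM (Φ : numberHalfDomain μ D) : Lp ℂ 2 μ →L[ℂ] Fock μ D :=
  LinearMap.mkContinuous
    { toFun := fun f => creation D f Φ
      map_add' := fun f g => Subtype.ext (createFormal_add f g _)
      map_smul' := fun c f => Subtype.ext (createFormal_smul c f _) }
    (Real.sqrt (∑' n : ℕ, ((n : ℝ) + 1) * ‖(Φ : Fock μ D) n‖ ^ 2))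
    fun f => norm_creation_apply_le f Φ

theorem createProd_append_cons (hs ks : List (Lp ℂ 2 μ)) (h : Lp ℂ 2 μ) (Ψ : FormalFock μ D) :
    createProd D (hs ++ h :: ks) Ψ = createFormal D h (createProd D (hs ++ ks) Ψ) := by
  induction hs with
  | nil => exact createProd_cons h ks Ψ
  | cons h' hs ih =>
    rw [List.cons_append, List.cons_append, createProd_cons, createProd_cons, ih]
    exact DFunLike.congr_fun (commute_createFormal h' h).eq (createProd D (hs ++ ks) Ψ)

variable {ι : Type*} (e : HilbertBasis ι ℂ (Lp ℂ 2 μ)) (B : Fin N → Matrix (Fin D) (Fin D) ℂ)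
  (g : Fin N → Lp ℂ 2 μ)

theorem mem_closure_testDomain_of_eq_createProd (v : EuclideanSpace ℂ (Fin D))
    (hs : List (Lp ℂ 2 μ)) (ls : List ι) {Ψ : Fock μ D}
    (hΨ : (fun n => Ψ n) = createProd D (hs ++ ls.map e) (dressedVacuum B g v)) :
    Ψ ∈ (testDomain B g e).topologicalClosure := by
  induction hs generalizing ls Ψ with
  | nil =>
    exact Submodule.le_topologicalClosure _
      (Submodule.subset_span ⟨v, ls, (isDressed_iff B g e v ls Ψ).2 hΨ⟩)
  | cons h hs ih =>
    have hrapid := createProd_mem_rapid (hs ++ ls.map e) (dressedVacuum_mem_rapid B g v)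
    let Φ : numberHalfDomain μ D :=
      ⟨⟨_, memℓp_of_mem_rapid hrapid⟩, mem_numberHalfDomain_of_mem_rapid hrapid⟩
    have hbasis (l : ι) : creationCLM Φ (e l) ∈ (testDomain B g e).topologicalClosure :=
      ih (l :: ls) (createProd_append_cons hs (ls.map e) (e l) _).symm
    have htop : (⊤ : Submodule ℂ (Lp ℂ 2 μ)) ≤
        (testDomain B g e).topologicalClosure.comap (creationCLM Φ).toLinearMap := by
      rw [← e.dense_span]
      exact Submodule.topologicalClosure_minimal _ (Submodule.span_le.2 (by
        rintro _ ⟨l, rfl⟩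
        exact hbasis l))
        ((Submodule.isClosed_topologicalClosure _).preimage (creationCLM Φ).continuous)
    have hΨΦ : Ψ = creationCLM Φ h := Subtype.ext (hΨ.trans (createProd_cons _ _ _))
    exact hΨΦ ▸ htop (Submodule.mem_top (x := h))

theorem mem_closure_testDomain_of_mem_dressedSpan {Ψ : Fock μ D}
    (hΨ : (fun n => Ψ n) ∈ dressedSpan B g Set.univ) :
    Ψ ∈ (testDomain B g e).topologicalClosure := by
  have hle : dressedSpan B g Set.univ ≤
      (testDomain B g e).topologicalClosure.map (components μ D) := by
    refine Submodule.span_le.2 ?_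
    rintro _ ⟨v, hs, -, rfl⟩
    refine ⟨⟨_, memℓp_of_mem_rapid (createProd_mem_rapid hs (dressedVacuum_mem_rapid B g v))⟩,
      mem_closure_testDomain_of_eq_createProd e B g v hs [] ?_, rfl⟩
    rw [List.map_nil, List.append_nil]
  obtain ⟨Φ, hΦ, hΦΨ⟩ := hle hΨ
  exact (Subtype.ext hΦΨ : Φ = Ψ) ▸ hΦ

variable {e B g}

theorem numberFormal_mem_dressedSpan (hB : ∀ j j', Commute (B j) (B j')) {s : Set (Lp ℂ 2 μ)}
    (hg : ∀ j, g j ∈ s) {Ψ : FormalFock μ D} (hΨ : Ψ ∈ dressedSpan B g s) :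
    numberFormal μ D Ψ ∈ dressedSpan B g s := by
  suffices dressedSpan B g s ≤ (dressedSpan B g s).comap (numberFormal μ D) from this hΨ
  refine Submodule.span_le.2 ?_
  rintro _ ⟨v, hs, hhs, rfl⟩
  have hcreate (j : Fin N) :
      createProd D hs (spinFormal μ (B j) (createFormal D (g j) (dressedVacuum B g v))) =
        createProd D (hs ++ [g j])
          (dressedVacuum B g (Matrix.toEuclideanCLM (n := Fin D) (𝕜 := ℂ) (B j) v)) := by
    rw [createProd_append_singleton, ← spinFormal_dressedVacuum (hB j)]
    exact congrArg _ (DFunLike.congr_fun (commute_spinFormal_createFormal (B j) (g j)).eq _)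
  change numberFormal μ D (createProd D hs (dressedVacuum B g v)) ∈ dressedSpan B g s
  rw [numberFormal_createProd, numberFormal_dressedVacuum, dressingGenerator_apply, map_neg,
    map_sum]
  refine add_mem (neg_mem (sum_mem fun j _ => ?_))
    (Submodule.smul_mem _ _ (createProd_mem_dressedSpan B g v hhs))
  rw [hcreate]
  refine createProd_mem_dressedSpan B g _ fun h hh => ?_
  rcases List.mem_append.1 hh with hh | hh
  · exact hhs h hh
  · exact List.mem_singleton.1 hh ▸ hg j

theorem inner_apply_eq_zero_of_mem_dressedSpan (hB : ∀ j j', Commute (B j) (B j'))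
    {Φ : Fock μ D} (hΦ : Φ ∈ (testDomain B g e)ᗮ) {Ψ : FormalFock μ D}
    (hΨ : Ψ ∈ dressedSpan B g Set.univ) (n : ℕ) :
    ⟪(Ψ n : NBody μ D n), Φ n⟫_ℂ = 0 := by
  have hpow (k : ℕ) : (numberFormal μ D ^ k) Ψ ∈ dressedSpan B g Set.univ := by
    induction k with
    | zero => exact hΨ
    | succ k ih =>
      rw [pow_succ', Module.End.mul_apply]
      exact numberFormal_mem_dressedSpan hB (fun _ => Set.mem_univ _) ih
  have hpow_apply (k n : ℕ) : (numberFormal μ D ^ k) Ψ n = (n : ℂ) ^ k • Ψ n := by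
    induction k with
    | zero => simp
    | succ k ih =>
      rw [pow_succ', Module.End.mul_apply, numberFormal_apply, ih, smul_smul, pow_succ']
  refine congrFun (eq_zero_of_hasSum_moments_eq_zero
    (d := fun n => ⟪(Ψ n : NBody μ D n), Φ n⟫_ℂ) (fun r => ?_) fun k => ?_) n
  · refine Summable.of_nonneg_of_le (fun n => by positivity) (fun n => ?_)
      ((dressedSpan_le_rapid B g _ hΨ r).mul_right ‖Φ‖)
    rw [mul_assoc]
    gcongr
    exact (norm_inner_le_norm _ _).trans
      (mul_le_mul_of_nonneg_left (lp.norm_apply_le_norm two_ne_zero Φ n) (norm_nonneg _))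
  · let Ψk : Fock μ D := ⟨_, memℓp_of_mem_rapid (dressedSpan_le_rapid B g _ (hpow k))⟩
    have hΨk : ⟪Ψk, Φ⟫_ℂ = 0 := by
      rw [← Submodule.orthogonal_closure] at hΦ
      exact hΦ Ψk (mem_closure_testDomain_of_mem_dressedSpan e B g (hpow k))
    rw [← hΨk]
    refine (lp.hasSum_inner Ψk Φ).congr_fun fun n => ?_
    change _ = ⟪((numberFormal μ D ^ k) Ψ n : NBody μ D n), Φ n⟫_ℂ
    rw [hpow_apply, Submodule.coe_smul, inner_smul_left, map_pow, map_natCast]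

/-- The lowest component of `a*(h₁) ⋯ a*(hₙ) T (v ⊗ Ω)` is `a*(h₁) ⋯ a*(hₙ) (v ⊗ Ω)`, and such
vectors are total in the `n`-boson sector. -/
theorem eq_zero_of_inner_createProd_eq_zero {n : ℕ} {φ : Sector μ D n}
    (hφ : ∀ v hs, hs.length = n →
      ⟪(createProd D hs (dressedVacuum B g v) n : NBody μ D n), φ⟫_ℂ = 0) : φ = 0 := by
  induction n with
  | zero =>
    obtain ⟨v, rfl⟩ := exists_vacuum_zero_eq φ
    have hvacuum := hφ v [] rfl
    rw [createProd_nil, dressedVacuum_zero, inner_self_eq_zero] at hvacuum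
    exact Subtype.ext hvacuum
  | succ n ih =>
    refine eq_zero_of_annihilateSector_eq_zero fun h => ih fun v hs hhs => ?_
    rw [← Submodule.coe_inner, annihilateSector, ContinuousLinearMap.adjoint_inner_right,
      ← createFormal_succ, ← createProd_cons]
    exact hφ v (h :: hs) (congrArg Nat.succ hhs)

theorem dense_testDomain (e : HilbertBasis ι ℂ (Lp ℂ 2 μ)) (hB : ∀ j j', Commute (B j) (B j'))
    (g : Fin N → Lp ℂ 2 μ) : Dense (testDomain B g e : Set (Fock μ D)) := by
  rw [Submodule.dense_iff_topologicalClosure_eq_top, Submodule.topologicalClosure_eq_top_iff,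
    Submodule.eq_bot_iff]
  intro Φ hΦ
  refine Subtype.ext (funext fun n => ?_)
  exact eq_zero_of_inner_createProd_eq_zero (B := B) (g := g) fun v hs _ =>
    inner_apply_eq_zero_of_mem_dressedSpan hB hΦ
      (createProd_mem_dressedSpan B g v fun _ _ => Set.mem_univ _) n

end Density

section FriedrichsExtension

variable {E : Type*} [NormedAddCommGroup E] [InnerProductSpace ℂ E]

/-- A Hilbert space `V` with a contraction `j : V → E` realises the completion of the domain of `A`
for the inner product `⟨u, A v⟩ + (1 - c) ⟨u, v⟩`. -/
structure IsFormCompletion (A : E →ₗ.[ℂ] E) (c : ℝ) {V : Type*} [NormedAddCommGroup V]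
    [InnerProductSpace ℂ V] (i : A.domain →ₗ[ℂ] V) (j : V →L[ℂ] E) : Prop where
  denseRange : DenseRange i
  inner_eq : ∀ u v : A.domain,
    ⟪i u, i v⟫_ℂ = ⟪(u : E), A v⟫_ℂ + ((1 - c : ℝ) : ℂ) * ⟪(u : E), (v : E)⟫_ℂ
  comp_eq : ∀ u : A.domain, j (i u) = u
  norm_le : ∀ x, ‖j x‖ ≤ ‖x‖

theorem exists_completion_of_core.{u} {E : Type*} [NormedAddCommGroup E] [InnerProductSpace ℂ E]
    [CompleteSpace E] {W : Type u} [AddCommGroup W] [Module ℂ W] (core : InnerProductSpace.Core ℂ W)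
    (j₀ : W →ₗ[ℂ] E) (hj₀ : ∀ u, ‖j₀ u‖ ^ 2 ≤ (core.inner u u).re) :
    ∃ (V : Type u) (_ : NormedAddCommGroup V) (_ : InnerProductSpace ℂ V) (_ : CompleteSpace V)
      (i : W →ₗ[ℂ] V) (j : V →L[ℂ] E), DenseRange i ∧ (∀ u v, ⟪i u, i v⟫_ℂ = core.inner u v) ∧
      (∀ u, j (i u) = j₀ u) ∧ ∀ x, ‖j x‖ ≤ ‖x‖ := by
  let _ : NormedAddCommGroup W := core.toNormedAddCommGroup
  let _ : InnerProductSpace ℂ W := InnerProductSpace.ofCore core.toCore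
  have hle : ∀ u : W, ‖j₀ u‖ ≤ ‖u‖ := fun u =>
    le_of_sq_le_sq (by rw [← inner_self_eq_norm_sq (𝕜 := ℂ) u]; exact hj₀ u) (norm_nonneg _)
  let j₁ : W →L[ℂ] E := j₀.mkContinuous 1 fun u => (hle u).trans_eq (one_mul _).symm
  let i : W →L[ℂ] UniformSpace.Completion W := UniformSpace.Completion.toComplL
  have hi : DenseRange i := UniformSpace.Completion.denseRange_coe
  have hcomp : ∀ u, j₁.extend i (i u) = j₁ u := fun u =>
    ContinuousLinearMap.extend_eq _ hi (UniformSpace.Completion.isUniformInducing_coe W) u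
  refine ⟨UniformSpace.Completion W, inferInstance, inferInstance, inferInstance,
    i.toLinearMap, j₁.extend i, hi, fun u v => ?_, hcomp, fun x => ?_⟩
  · exact UniformSpace.Completion.inner_coe (𝕜 := ℂ) (E := W) u v
  · refine hi.induction_on (p := fun x => ‖j₁.extend i x‖ ≤ ‖x‖) x
      (isClosed_le (by fun_prop) (by fun_prop)) fun u => ?_
    rw [hcomp]
    exact (hle u).trans (UniformSpace.Completion.norm_coe u).ge

variable {A : E →ₗ.[ℂ] E} {c : ℝ}

theorem IsBoundedBelowBy.norm_sq_le (hc : IsBoundedBelowBy A c) (u : A.domain) :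
    ‖(u : E)‖ ^ 2 ≤ (⟪(u : E), A u⟫_ℂ + ((1 - c : ℝ) : ℂ) * ⟪(u : E), (u : E)⟫_ℂ).re := by
  have hu := hc u
  rw [inner_self_eq_norm_sq_to_K]
  simp only [Complex.add_re, Complex.coe_algebraMap, ← Complex.ofReal_pow, ← Complex.ofReal_mul,
    Complex.ofReal_re]
  linarith

theorem exists_isFormCompletion.{u} {E : Type u} [NormedAddCommGroup E] [InnerProductSpace ℂ E]
    [CompleteSpace E] {A : E →ₗ.[ℂ] E} (hA : A.IsFormalAdjoint A) {c : ℝ}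
    (hc : IsBoundedBelowBy A c) :
    ∃ (V : Type u) (_ : NormedAddCommGroup V) (_ : InnerProductSpace ℂ V) (_ : CompleteSpace V)
      (i : A.domain →ₗ[ℂ] V) (j : V →L[ℂ] E), IsFormCompletion A c i j := by
  let core : InnerProductSpace.Core ℂ A.domain :=
    { inner := fun u v => ⟪(u : E), A v⟫_ℂ + ((1 - c : ℝ) : ℂ) * ⟪(u : E), (v : E)⟫_ℂ
      conj_inner_symm := fun u v => by
        simp only [map_add, map_mul, inner_conj_symm, Complex.conj_ofReal]
        rw [hA u v]
      re_inner_nonneg := fun u => (sq_nonneg _).trans (hc.norm_sq_le u)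
      add_left := fun u v w => by
        simp only [Submodule.coe_add, inner_add_left]
        ring
      smul_left := fun u v r => by
        simp only [Submodule.coe_smul, inner_smul_left]
        ring
      definite := fun u hu => by
        have h := hc.norm_sq_le u
        rw [show ⟪(u : E), A u⟫_ℂ + ((1 - c : ℝ) : ℂ) * ⟪(u : E), (u : E)⟫_ℂ = 0 from hu,
          Complex.zero_re] at h
        exact Subtype.ext (norm_eq_zero.1 (sq_nonpos_iff _ |>.1 h)) }
  obtain ⟨V, _, _, _, i, j, hdense, hinner, hcomp, hbound⟩ :=
    exists_completion_of_core core A.domain.subtype hc.norm_sq_le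
  exact ⟨V, _, _, ‹_›, i, j, hdense, hinner, hcomp, hbound⟩

variable {V : Type*} [NormedAddCommGroup V] [InnerProductSpace ℂ V]
  {i : A.domain →ₗ[ℂ] V} {j : V →L[ℂ] E}

theorem IsFormCompletion.norm_sq (h : IsFormCompletion A c i j) (u : A.domain) :
    ‖i u‖ ^ 2 = (⟪(u : E), A u⟫_ℂ).re + (1 - c) * ‖(u : E)‖ ^ 2 := by
  rw [← inner_self_eq_norm_sq (𝕜 := ℂ), h.inner_eq, inner_self_eq_norm_sq_to_K]
  simp [← Complex.ofReal_pow]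

theorem IsFormCompletion.tendsto_form_iff_cauchySeq (h : IsFormCompletion A c i j)
    {u : ℕ → A.domain} (hu : CauchySeq fun n => (u n : E)) :
    Tendsto (fun p : ℕ × ℕ => (⟪((u p.1 - u p.2 : A.domain) : E), A (u p.1 - u p.2)⟫_ℂ).re)
      atTop (𝓝 0) ↔ CauchySeq fun n => i (u n) := by
  have hform : ∀ p : ℕ × ℕ, (⟪((u p.1 - u p.2 : A.domain) : E), A (u p.1 - u p.2)⟫_ℂ).re =
      dist (i (u p.1)) (i (u p.2)) ^ 2 - (1 - c) * dist (u p.1 : E) (u p.2) ^ 2 := fun p => by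
    rw [dist_eq_norm, dist_eq_norm, ← map_sub, h.norm_sq, Submodule.coe_sub, add_sub_cancel_right]
  have hE : Tendsto (fun p : ℕ × ℕ => (1 - c) * dist (u p.1 : E) (u p.2) ^ 2) atTop (𝓝 0) := by
    simpa using ((cauchySeq_iff_tendsto_dist_atTop_0.1 hu).pow 2).const_mul (1 - c)
  simp only [hform, cauchySeq_iff_tendsto_dist_atTop_0]
  constructor
  · intro hlim
    simpa [Real.sqrt_sq] using (hlim.add hE).sqrt
  · intro hlim
    simpa using (hlim.pow 2).sub hE

theorem IsFormCompletion.formDomain_eq [CompleteSpace V] (h : IsFormCompletion A c i j) :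
    formDomain A = Set.range j := by
  ext ψ
  constructor
  · rintro ⟨u, hu, hform⟩
    obtain ⟨x, hx⟩ := cauchySeq_tendsto_of_complete
      ((h.tendsto_form_iff_cauchySeq hu.cauchySeq).1 hform)
    refine ⟨x, tendsto_nhds_unique ((j.continuous.tendsto x).comp hx) ?_⟩
    exact hu.congr fun n => (h.comp_eq _).symm
  · rintro ⟨x, rfl⟩
    obtain ⟨y, hy, hyx⟩ := mem_closure_iff_seq_limit.1 (h.denseRange x)
    choose u hu using hy
    have hux : Tendsto (fun n => i (u n)) atTop (𝓝 x) := by simpa only [hu] using hyx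
    have hjx : Tendsto (fun n => (u n : E)) atTop (𝓝 (j x)) := by
      simpa only [Function.comp_def, h.comp_eq] using (j.continuous.tendsto x).comp hux
    exact ⟨u, hjx, (h.tendsto_form_iff_cauchySeq hjx.cauchySeq).2 hux.cauchySeq⟩

theorem IsFormCompletion.inner_coe (h : IsFormCompletion A c i j) (hA : A.IsFormalAdjoint A)
    (u : A.domain) (x : V) :
    ⟪i u, x⟫_ℂ = ⟪A u, j x⟫_ℂ + ((1 - c : ℝ) : ℂ) * ⟪(u : E), j x⟫_ℂ := by
  refine h.denseRange.induction_on (p := fun x => ⟪i u, x⟫_ℂ = ⟪A u, j x⟫_ℂ +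
    ((1 - c : ℝ) : ℂ) * ⟪(u : E), j x⟫_ℂ) x
    (isClosed_eq (by fun_prop) (by fun_prop)) fun v => ?_
  rw [h.inner_eq, h.comp_eq, hA u v]

variable [CompleteSpace E]

theorem IsFormCompletion.inner_adjoint (h : IsFormCompletion A c i j) (hA : A.IsFormalAdjoint A)
    (hd : Dense (A.domain : Set E)) (x y : V) (hy : j y ∈ A†.domain) :
    ⟪j x, A† ⟨j y, hy⟩⟫_ℂ + ((1 - c : ℝ) : ℂ) * ⟪j x, j y⟫_ℂ = ⟪x, y⟫_ℂ := by
  refine h.denseRange.induction_on (p := fun x => ⟪j x, A† ⟨j y, hy⟩⟫_ℂ +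
    ((1 - c : ℝ) : ℂ) * ⟪j x, j y⟫_ℂ = ⟪x, y⟫_ℂ) x
    (isClosed_eq (by fun_prop) (by fun_prop)) fun u => ?_
  rw [h.inner_coe hA, h.comp_eq, (LinearPMap.adjoint_isFormalAdjoint hd).symm u ⟨j y, hy⟩]

theorem IsFormCompletion.exists_adjoint_eq [CompleteSpace V] (h : IsFormCompletion A c i j)
    (hA : A.IsFormalAdjoint A) (hd : Dense (A.domain : Set E)) (η : E) :
    ∃ (x : V) (hx : j x ∈ A†.domain), A† ⟨j x, hx⟩ + ((1 - c : ℝ) : ℂ) • j x = η := by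
  have hadjoint : ∀ u : A.domain, ⟪η - ((1 - c : ℝ) : ℂ) • j (j.adjoint η), (u : E)⟫_ℂ =
      ⟪j (j.adjoint η), A u⟫_ℂ := by
    intro u
    have hinner := h.inner_coe hA u (j.adjoint η)
    rw [ContinuousLinearMap.adjoint_inner_right, h.comp_eq] at hinner
    have hinner_symm := congrArg (starRingEnd ℂ) hinner
    simp only [map_add, map_mul, inner_conj_symm, Complex.conj_ofReal] at hinner_symm
    rw [inner_sub_left, inner_smul_left, Complex.conj_ofReal, hinner_symm]
    ring
  have hx : j (j.adjoint η) ∈ A†.domain := LinearPMap.mem_adjoint_domain_of_exists _ ⟨_, hadjoint⟩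
  refine ⟨j.adjoint η, hx, ?_⟩
  rw [LinearPMap.adjoint_apply_eq hd ⟨_, hx⟩ hadjoint, sub_add_cancel]

theorem isSelfAdjoint_of_surjective_add_smul {𝕜 H : Type*} [RCLike 𝕜] [NormedAddCommGroup H]
    [InnerProductSpace 𝕜 H] [CompleteSpace H] {F : H →ₗ.[𝕜] H} (hF : F.IsFormalAdjoint F)
    (hd : Dense (F.domain : Set H)) (a : ℝ)
    (hs : ∀ η : H, ∃ x : F.domain, F x + (a : 𝕜) • (x : H) = η) : IsSelfAdjoint F := by
  rw [LinearPMap.isSelfAdjoint_def]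
  have hle : F ≤ F† := hF.le_adjoint hd
  refine (LinearPMap.eq_of_le_of_domain_eq hle (le_antisymm hle.1 fun φ hφ => ?_)).symm
  obtain ⟨ψ, hψ⟩ := hs (F† ⟨φ, hφ⟩ + (a : 𝕜) • φ)
  suffices φ = ψ from this ▸ ψ.2
  refine ext_inner_left 𝕜 fun η => ?_
  obtain ⟨χ, rfl⟩ := hs η
  have hadjoint : ⟪(χ : H), F† ⟨φ, hφ⟩ + (a : 𝕜) • φ⟫_𝕜 = ⟪F χ + (a : 𝕜) • (χ : H), φ⟫_𝕜 := by
    rw [inner_add_right, inner_add_left, inner_smul_left, inner_smul_right, RCLike.conj_ofReal,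
      (LinearPMap.adjoint_isFormalAdjoint hd).symm χ ⟨φ, hφ⟩]
  have hformal : ⟪(χ : H), F ψ + (a : 𝕜) • (ψ : H)⟫_𝕜 = ⟪F χ + (a : 𝕜) • (χ : H), (ψ : H)⟫_𝕜 := by
    rw [inner_add_right, inner_add_left, inner_smul_left, inner_smul_right, RCLike.conj_ofReal,
      hF χ ψ]
  rw [← hadjoint, ← hformal, hψ]

/-- The restriction of `A†` to the range of `j`. For the embedding `j` of the form completion this
range is the form domain of `A`, and the restriction is the Friedrichs extension. -/
def adjointRestrict (A : E →ₗ.[ℂ] E) (j : V →L[ℂ] E) : E →ₗ.[ℂ] E :=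
  (A†).domRestrict (LinearMap.range j.toLinearMap)

theorem adjointRestrict_le : adjointRestrict A j ≤ A† := LinearPMap.domRestrict_le

theorem exists_adjointRestrict_eq (ψ : (adjointRestrict A j).domain) :
    ∃ (x : V) (hx : j x ∈ A†.domain), (ψ : E) = j x ∧ adjointRestrict A j ψ = A† ⟨j x, hx⟩ := by
  obtain ⟨_, ⟨x, rfl⟩, hψ⟩ := ψ
  exact ⟨x, hψ, rfl, adjointRestrict_le.2 rfl⟩

theorem IsFormCompletion.isFriedrichsExtension [CompleteSpace V] (h : IsFormCompletion A c i j) :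
    IsFriedrichsExtension A (adjointRestrict A j) :=
  ⟨adjointRestrict_le, fun ψ => by rw [h.formDomain_eq, and_comm]; rfl⟩

theorem IsFormCompletion.le_adjointRestrict (h : IsFormCompletion A c i j)
    (hA : A.IsFormalAdjoint A) (hd : Dense (A.domain : Set E)) : A ≤ adjointRestrict A j := by
  have hle := hA.le_adjoint hd
  refine ⟨fun ψ hψ => ⟨⟨i ⟨ψ, hψ⟩, h.comp_eq _⟩, hle.1 hψ⟩, fun u v huv => ?_⟩
  exact (hle.2 (y := ⟨u, hle.1 u.2⟩) rfl).trans
    ((adjointRestrict_le (A := A) (j := j)).2 (y := ⟨u, hle.1 u.2⟩) huv.symm).symm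

theorem IsFormCompletion.isFormalAdjoint_adjointRestrict (h : IsFormCompletion A c i j)
    (hA : A.IsFormalAdjoint A) (hd : Dense (A.domain : Set E)) :
    (adjointRestrict A j).IsFormalAdjoint (adjointRestrict A j) := by
  intro φ ψ
  obtain ⟨x, hx, hφ, hFφ⟩ := exists_adjointRestrict_eq φ
  obtain ⟨y, hy, hψ, hFψ⟩ := exists_adjointRestrict_eq ψ
  have hxy := h.inner_adjoint hA hd x y hy
  have hyx := congrArg (starRingEnd ℂ) (h.inner_adjoint hA hd y x hx)
  simp only [map_add, map_mul, inner_conj_symm, Complex.conj_ofReal] at hyx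
  rw [hφ, hFφ, hψ, hFψ]
  exact add_right_cancel (hyx.trans hxy.symm)

theorem IsFormCompletion.isSelfAdjoint_adjointRestrict [CompleteSpace V]
    (h : IsFormCompletion A c i j) (hA : A.IsFormalAdjoint A) (hd : Dense (A.domain : Set E)) :
    IsSelfAdjoint (adjointRestrict A j) := by
  refine isSelfAdjoint_of_surjective_add_smul (h.isFormalAdjoint_adjointRestrict hA hd)
    (hd.mono (h.le_adjointRestrict hA hd).1) (1 - c) fun η => ?_
  obtain ⟨x, hx, hη⟩ := h.exists_adjoint_eq hA hd η
  exact ⟨⟨j x, ⟨x, rfl⟩, hx⟩, hη ▸ congrArg (· + _) (adjointRestrict_le.2 rfl)⟩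

theorem IsFormCompletion.isBoundedBelowBy_adjointRestrict (h : IsFormCompletion A c i j)
    (hA : A.IsFormalAdjoint A) (hd : Dense (A.domain : Set E)) :
    IsBoundedBelowBy (adjointRestrict A j) c := by
  intro ψ
  obtain ⟨x, hx, hψ, hFψ⟩ := exists_adjointRestrict_eq ψ
  have hform := congrArg Complex.re (h.inner_adjoint hA hd x x hx)
  rw [inner_self_eq_norm_sq_to_K (j x), inner_self_eq_norm_sq_to_K x] at hform
  simp only [Complex.add_re, Complex.coe_algebraMap, ← Complex.ofReal_pow,
    ← Complex.ofReal_mul, Complex.ofReal_re] at hform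
  rw [hψ, hFψ]
  nlinarith [h.norm_le x, norm_nonneg (j x)]

theorem exists_isFriedrichsExtension (hA : A.IsFormalAdjoint A)
    (hd : Dense (A.domain : Set E)) (hc : IsBoundedBelowBy A c) :
    ∃ F : E →ₗ.[ℂ] E, IsFriedrichsExtension A F ∧ A ≤ F ∧ IsSelfAdjoint F ∧
      IsBoundedBelowBy F c := by
  obtain ⟨V, _, _, _, i, j, h⟩ := exists_isFormCompletion hA hc
  exact ⟨adjointRestrict A j, h.isFriedrichsExtension, h.le_adjointRestrict hA hd,
    h.isSelfAdjoint_adjointRestrict hA hd, h.isBoundedBelowBy_adjointRestrict hA hd⟩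

end FriedrichsExtension

section Displaced

variable {X : Type*} [MeasurableSpace X] {μ : Measure X} [SigmaFinite μ] {D N : ℕ}

theorem inner_spin_left (M : Matrix (Fin D) (Fin D) ℂ) (Ψ Φ : Fock μ D) :
    ⟪spin μ M Ψ, Φ⟫_ℂ = ⟪Ψ, spin μ M.conjTranspose Φ⟫_ℂ := by
  rw [lp.inner_eq_tsum, lp.inner_eq_tsum]
  exact tsum_congr fun n => inner_spinSector_left M _ _

theorem annihilation_isFormalAdjoint_creation (h : Lp ℂ 2 μ) :
    (annihilation D h).IsFormalAdjoint (creation D h) := by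
  intro Ψ Φ
  have hsum : Summable fun n => ⟪(Ψ : Fock μ D) n, creation D h Φ n⟫_ℂ :=
    lp.summable_inner (Ψ : Fock μ D) (creation D h Φ)
  have hzero : creation D h Φ 0 = 0 := rfl
  rw [lp.inner_eq_tsum, lp.inner_eq_tsum, hsum.tsum_eq_zero_add, hzero, inner_zero_right, zero_add]
  refine tsum_congr fun n => ?_
  have hΨ : annihilation D h Ψ n = annihilateSector D h n ((Ψ : Fock μ D) (n + 1)) := rfl
  have hΦ : creation D h Φ (n + 1) = createSector D h n ((Φ : Fock μ D) n) := rfl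
  rw [hΨ, hΦ, annihilateSector, ContinuousLinearMap.adjoint_inner_left]

theorem displaced_apply (B : Fin N → Matrix (Fin D) (Fin D) ℂ) (g : Fin N → Lp ℂ 2 μ)
    (h : Lp ℂ 2 μ) (Ψ : numberHalfDomain μ D) :
    displaced B g h Ψ = (∑ j, ⟪h, g j⟫_ℂ • spin μ (B j) (Ψ : Fock μ D)) + annihilation D h Ψ :=
  (LinearPMap.vadd_apply (∑ j, ⟪h, g j⟫_ℂ • (spin μ (B j)).toLinearMap) (annihilation D h)
    Ψ).trans (by simp)

theorem displaced_apply_eq_displacedFormal (B : Fin N → Matrix (Fin D) (Fin D) ℂ)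
    (g : Fin N → Lp ℂ 2 μ) (h : Lp ℂ 2 μ) (Ψ : numberHalfDomain μ D) :
    (fun n => displaced B g h Ψ n) = displacedFormal B g h fun n => (Ψ : Fock μ D) n := by
  funext n
  rw [displaced_apply, displacedFormal, LinearMap.add_apply, shiftFormal_apply, Pi.add_apply,
    Finset.sum_apply, add_comm, lp.coeFn_add, Pi.add_apply, lp.coeFn_sum, Finset.sum_apply]
  rfl

theorem dense_numberHalfDomain (μ : Measure X) [SigmaFinite μ] (D : ℕ) :
    Dense (numberHalfDomain μ D : Set (Fock μ D)) := by
  obtain ⟨w, e, -⟩ := exists_hilbertBasis ℂ (Lp ℂ 2 μ)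
  let B : Fin 0 → Matrix (Fin D) (Fin D) ℂ := Fin.elim0
  exact (dense_testDomain (B := B) e (fun j => j.elim0) Fin.elim0).mono fun Ψ hΨ =>
    mem_numberHalfDomain_of_mem_rapid (dressedSpan_le_rapid B _ _ (mem_testDomain_iff.1 hΨ))

/-- The bounded map `h ↦ â(h)* Φ = a*(h) Φ + ∑ⱼ ⟨gⱼ, h⟩ Bⱼ* Φ`, for a fixed vector `Φ` of the
domain. -/
def displacedAdjoint (B : Fin N → Matrix (Fin D) (Fin D) ℂ) (g : Fin N → Lp ℂ 2 μ)
    (Φ : numberHalfDomain μ D) : Lp ℂ 2 μ →L[ℂ] Fock μ D :=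
  creationCLM Φ + ∑ j, (innerSL ℂ (g j)).smulRight (spin μ (B j).conjTranspose Φ)

theorem displacedAdjoint_apply (B : Fin N → Matrix (Fin D) (Fin D) ℂ) (g : Fin N → Lp ℂ 2 μ)
    (Φ : numberHalfDomain μ D) (h : Lp ℂ 2 μ) :
    displacedAdjoint B g Φ h =
      creation D h Φ + ∑ j, ⟪g j, h⟫_ℂ • spin μ (B j).conjTranspose (Φ : Fock μ D) := by
  simp [displacedAdjoint, creationCLM]

theorem inner_displaced (B : Fin N → Matrix (Fin D) (Fin D) ℂ) (g : Fin N → Lp ℂ 2 μ)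
    (h : Lp ℂ 2 μ) (Ψ Φ : numberHalfDomain μ D) :
    ⟪displaced B g h Ψ, (Φ : Fock μ D)⟫_ℂ = ⟪(Ψ : Fock μ D), displacedAdjoint B g Φ h⟫_ℂ := by
  rw [displaced_apply, displacedAdjoint_apply, inner_add_left, inner_add_right,
    annihilation_isFormalAdjoint_creation h Ψ Φ, sum_inner, inner_sum, add_comm]
  congr 1
  refine Finset.sum_congr rfl fun j _ => ?_
  rw [inner_smul_left, inner_smul_right, inner_conj_symm, inner_spin_left]

theorem mem_graph_adjoint_displaced (B : Fin N → Matrix (Fin D) (Fin D) ℂ)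
    (g : Fin N → Lp ℂ 2 μ) (h : Lp ℂ 2 μ) (Φ : numberHalfDomain μ D) :
    ((Φ : Fock μ D), displacedAdjoint B g Φ h) ∈ ((displaced B g h)†).graph := by
  rw [LinearPMap.adjoint_graph_eq_graph_adjoint (dense_numberHalfDomain μ D),
    Submodule.mem_adjoint_iff]
  intro Ψ Ψ' hΨ
  obtain ⟨χ, rfl, rfl⟩ := (LinearPMap.mem_graph_iff _).1 hΨ
  exact sub_eq_zero.2 (inner_displaced B g h χ Φ)

theorem createFormal_mem_dressedSpan {B : Fin N → Matrix (Fin D) (Fin D) ℂ}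
    {g : Fin N → Lp ℂ 2 μ} {s : Set (Lp ℂ 2 μ)} {f : Lp ℂ 2 μ} (hf : f ∈ s)
    {Ψ : FormalFock μ D} (hΨ : Ψ ∈ dressedSpan B g s) :
    createFormal D f Ψ ∈ dressedSpan B g s := by
  suffices dressedSpan B g s ≤ (dressedSpan B g s).comap (createFormal D f) from this hΨ
  refine Submodule.span_le.2 ?_
  rintro _ ⟨v, hs, hhs, rfl⟩
  change createFormal D f (createProd D hs (dressedVacuum B g v)) ∈ dressedSpan B g s
  rw [← createProd_cons]
  exact createProd_mem_dressedSpan B g v (List.forall_mem_cons.2 ⟨hf, hhs⟩)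

theorem displacedFormal_mem_dressedSpan {B : Fin N → Matrix (Fin D) (Fin D) ℂ}
    (hB : ∀ j j', Commute (B j) (B j')) {g : Fin N → Lp ℂ 2 μ} {s : Set (Lp ℂ 2 μ)}
    (h : Lp ℂ 2 μ) {Ψ : FormalFock μ D} (hΨ : Ψ ∈ dressedSpan B g s) :
    displacedFormal B g h Ψ ∈ dressedSpan B g s := by
  suffices dressedSpan B g s ≤ (dressedSpan B g s).comap (displacedFormal B g h) from this hΨ
  refine Submodule.span_le.2 ?_
  rintro _ ⟨v, hs, hhs, rfl⟩
  change displacedFormal B g h (createProd D hs (dressedVacuum B g v)) ∈ dressedSpan B g s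
  induction hs with
  | nil =>
    rw [createProd_nil, displacedFormal_dressedVacuum hB]
    exact zero_mem _
  | cons f hs ih =>
    obtain ⟨hf, hhs⟩ := List.forall_mem_cons.1 hhs
    rw [createProd_cons, displacedFormal_createFormal]
    exact add_mem (createFormal_mem_dressedSpan hf (ih hhs))
      (Submodule.smul_mem _ _ (createProd_mem_dressedSpan B g v hhs))

theorem displacedFormal_createProd_eq_zero {B : Fin N → Matrix (Fin D) (Fin D) ℂ}
    (hB : ∀ j j', Commute (B j) (B j')) (g : Fin N → Lp ℂ 2 μ) (v : EuclideanSpace ℂ (Fin D))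
    {h : Lp ℂ 2 μ} {hs : List (Lp ℂ 2 μ)} (horth : ∀ f ∈ hs, ⟪h, f⟫_ℂ = 0) :
    displacedFormal B g h (createProd D hs (dressedVacuum B g v)) = 0 := by
  induction hs with
  | nil => exact displacedFormal_dressedVacuum hB g h v
  | cons f hs ih =>
    obtain ⟨hf, hhs⟩ := List.forall_mem_cons.1 horth
    rw [createProd_cons, displacedFormal_createFormal, ih hhs, hf, map_zero, zero_smul, add_zero]

theorem finite_support_displacedFormal {ι : Type*} {e : ι → Lp ℂ 2 μ} (he : Orthonormal ℂ e)
    {B : Fin N → Matrix (Fin D) (Fin D) ℂ} (hB : ∀ j j', Commute (B j) (B j'))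
    {g : Fin N → Lp ℂ 2 μ} {Ψ : FormalFock μ D} (hΨ : Ψ ∈ dressedSpan B g (Set.range e)) :
    (Function.support fun l => displacedFormal B g (e l) Ψ).Finite := by
  induction hΨ using Submodule.span_induction with
  | mem Ψ hΨ =>
    obtain ⟨v, hs, hhs, rfl⟩ := hΨ
    obtain ⟨ls, rfl⟩ : hs ∈ Set.range (List.map e) := by rwa [Set.range_list_map]
    refine (List.finite_toSet ls).subset fun l hl => ?_
    by_contra hls
    refine hl (displacedFormal_createProd_eq_zero hB g v (List.forall_mem_map.2 fun l' hl' => ?_))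
    exact he.2 fun hll' => hls (hll' ▸ hl')
  | zero => simp
  | add Ψ Φ _ _ hΨ hΦ =>
    simp only [map_add]
    exact (hΨ.union hΦ).subset (Function.support_add _ _)
  | smul c Ψ _ hΨ =>
    simp only [map_smul]
    exact hΨ.subset (Function.support_const_smul_subset c _)

theorem exists_displaced_graph {ι : Type*} {e : ι → Lp ℂ 2 μ} (he : Orthonormal ℂ e)
    {B : Fin N → Matrix (Fin D) (Fin D) ℂ} (hB : ∀ j j', Commute (B j) (B j'))
    {g : Fin N → Lp ℂ 2 μ} {Ψ : Fock μ D} (hΨ : Ψ ∈ testDomain B g e) :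
    ∃ u : ι → numberHalfDomain μ D,
      (∀ l, (Ψ, (u l : Fock μ D)) ∈ (displaced B g (e l)).graph) ∧ (Function.support u).Finite := by
  rw [mem_testDomain_iff] at hΨ
  have hrapid (l : ι) : displacedFormal B g (e l) (fun n => Ψ n) ∈ rapid μ D :=
    dressedSpan_le_rapid B g _ (displacedFormal_mem_dressedSpan hB (e l) hΨ)
  have hΨN := mem_numberHalfDomain_of_mem_rapid (dressedSpan_le_rapid B g _ hΨ)
  refine ⟨fun l => ⟨⟨_, memℓp_of_mem_rapid (hrapid l)⟩,
    mem_numberHalfDomain_of_mem_rapid (hrapid l)⟩, fun l => ?_, ?_⟩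
  · exact (LinearPMap.mem_graph_iff _).2 ⟨⟨Ψ, hΨN⟩, rfl,
      Subtype.ext (displaced_apply_eq_displacedFormal B g (e l) ⟨Ψ, hΨN⟩)⟩
  · refine (finite_support_displacedFormal he hB hΨ).subset fun l hl hzero => hl ?_
    exact Subtype.ext (Subtype.ext hzero)

end Displaced

section Positivity

variable {E F : Type*} [NormedAddCommGroup E] [InnerProductSpace ℂ E]
  [NormedAddCommGroup F] [InnerProductSpace ℂ F] {κ : Type*}

open scoped ComplexOrder in
theorem posSemidef_inner_apply [Finite κ] {A : E →ₗ.[ℂ] E} (hA : A.IsFormalAdjoint A)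
    (hA0 : IsBoundedBelowBy A 0) (φ : κ → A.domain) :
    (Matrix.of fun i j => ⟪(φ i : E), A (φ j)⟫_ℂ).PosSemidef := by
  have := Fintype.ofFinite κ
  refine .of_dotProduct_mulVec_nonneg (Matrix.ext fun i j => ?_) fun x => ?_
  · exact (inner_conj_symm _ _).trans (hA _ _)
  · set χ : A.domain := ∑ i, x i • φ i with hχ
    have hquadratic : star x ⬝ᵥ (Matrix.of fun i j => ⟪(φ i : E), A (φ j)⟫_ℂ).mulVec x =
        ⟪(χ : E), A χ⟫_ℂ := by
      have hAχ : A χ = ∑ j, x j • A (φ j) := by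
        simp only [hχ, ← LinearPMap.toFun_eq_coe, map_sum, map_smul]
      rw [hAχ, hχ]
      simp only [AddSubmonoidClass.coe_finsetSum, Submodule.coe_smul, sum_inner, inner_sum,
        inner_smul_left, inner_smul_right, dotProduct, Matrix.mulVec, Matrix.of_apply,
        Pi.star_apply, RCLike.star_def, Finset.mul_sum]
      rw [Finset.sum_comm]
      exact Finset.sum_congr rfl fun i _ => Finset.sum_congr rfl fun j _ => by ring
    have him : (⟪(χ : E), A χ⟫_ℂ).im = 0 := by
      rw [← Complex.conj_eq_iff_im, inner_conj_symm, hA]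
    have hre : 0 ≤ (⟪(χ : E), A χ⟫_ℂ).re := by simpa using hA0 χ
    rw [hquadratic]
    exact Complex.nonneg_iff.2 ⟨hre, him.symm⟩

open scoped ComplexOrder in
theorem re_sum_mul_inner_nonneg [Fintype κ] {M : Matrix κ κ ℂ} (hM : M.PosSemidef) (u : κ → F) :
    0 ≤ (∑ i, ∑ j, M i j * ⟪u i, u j⟫_ℂ).re := by
  have hschur := (hM.hadamard (Matrix.posSemidef_gram ℂ u)).dotProduct_mulVec_nonneg fun _ => 1
  simpa [dotProduct, Matrix.mulVec] using (Complex.nonneg_iff.1 hschur).1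

theorem neg_norm_mul_sq_le_re_inner (A : E →L[ℂ] E) (x : E) :
    -‖A‖ * ‖x‖ ^ 2 ≤ (⟪x, A x⟫_ℂ).re := by
  rw [neg_mul]
  refine neg_le_of_abs_le ?_
  calc |(⟪x, A x⟫_ℂ).re| ≤ ‖⟪x, A x⟫_ℂ‖ := Complex.abs_re_le_norm _
    _ ≤ ‖x‖ * ‖A x‖ := norm_inner_le_norm _ _
    _ ≤ ‖x‖ * (‖A‖ * ‖x‖) := by
        gcongr
        exact A.le_opNorm x
    _ = ‖A‖ * ‖x‖ ^ 2 := by ring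

variable {X : Type*} [MeasurableSpace X] {μ : Measure X}

theorem coeFn_mulOp (ω : X → ℝ) (φ : (mulOp μ ω).domain) :
    mulOp μ ω φ =ᵐ[μ] fun x => (ω x : ℂ) * (φ : Lp ℂ 2 μ) x :=
  (memLp_mul φ).coeFn_toLp

theorem mulOp_isFormalAdjoint (ω : X → ℝ) : (mulOp μ ω).IsFormalAdjoint (mulOp μ ω) := by
  intro φ χ
  rw [L2.inner_def, L2.inner_def]
  refine integral_congr_ae ?_
  filter_upwards [coeFn_mulOp ω φ, coeFn_mulOp ω χ] with x hφ hχ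
  rw [hφ, hχ, RCLike.inner_apply, RCLike.inner_apply, map_mul, Complex.conj_ofReal]
  ring

theorem mulOp_isBoundedBelowBy {ω : X → ℝ} {c : ℝ} (hω : ∀ᵐ x ∂μ, c ≤ ω x) :
    IsBoundedBelowBy (mulOp μ ω) c := by
  intro φ
  have hinner : (⟪(φ : Lp ℂ 2 μ), mulOp μ ω φ⟫_ℂ).re =
      ∫ x, (⟪(φ : Lp ℂ 2 μ) x, mulOp μ ω φ x⟫_ℂ).re ∂μ := by
    rw [L2.inner_def]
    exact (integral_re (L2.integrable_inner (𝕜 := ℂ) (φ : Lp ℂ 2 μ) (mulOp μ ω φ))).symm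
  rw [norm_sq_L2, hinner, ← integral_const_mul]
  refine integral_mono_ae
    (((memLp_two_iff_integrable_sq_norm (Lp.aestronglyMeasurable _)).1 (Lp.memLp _)).const_mul c)
    (L2.integrable_inner (𝕜 := ℂ) (φ : Lp ℂ 2 μ) (mulOp μ ω φ)).re ?_
  filter_upwards [hω, coeFn_mulOp ω φ] with x hx hφ
  have hpointwise : (⟪(φ : Lp ℂ 2 μ) x, mulOp μ ω φ x⟫_ℂ).re = ω x * ‖(φ : Lp ℂ 2 μ) x‖ ^ 2 := by
    rw [hφ, RCLike.inner_apply, mul_assoc, Complex.mul_conj', ← Complex.ofReal_pow,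
      ← Complex.ofReal_mul, Complex.ofReal_re]
  rw [hpointwise]
  gcongr

end Positivity

section Hamiltonian

variable {X : Type*} [MeasurableSpace X] {μ : Measure X} {ι : Type*}

theorem hasSum_prod_of_finite_right {κ E : Type*} [AddCommMonoid E] [TopologicalSpace E]
    [ContinuousAdd E] {F : ι × κ → E} {S : κ → E} {s : Finset κ}
    (hzero : ∀ i, ∀ k ∉ s, F (i, k) = 0) (hF : ∀ k ∈ s, HasSum (fun i => F (i, k)) (S k)) :
    HasSum F (∑ k ∈ s, S k) := by
  classical
  have hcolumn (k : κ) (hk : k ∈ s) : HasSum (fun p => if p.2 = k then F p else 0) (S k) := by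
    have hinj : Function.Injective fun i : ι => (i, k) := fun _ _ h => (Prod.mk.inj h).1
    refine (hinj.hasSum_iff fun p hp => if_neg fun hpk => hp ⟨p.1, ?_⟩).1 ?_
    · rw [← hpk]
    · simpa [Function.comp_def] using hF k hk
  refine (hasSum_sum hcolumn).congr_fun fun p => ?_
  by_cases hp : p.2 ∈ s
  · simp [hp]
  · simp [hzero p.1 p.2 hp]

variable [SigmaFinite μ] {D N : ℕ} {K : Matrix (Fin D) (Fin D) ℂ}
  {B : Fin N → Matrix (Fin D) (Fin D) ℂ} {g : Fin N → Lp ℂ 2 μ} {ω : X → ℝ}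

section

variable {e : ι → Lp ℂ 2 μ} {he : ∀ l, e l ∈ (mulOp μ ω).domain}

theorem HasRenormalizedAction.unique {Ψ Φ Φ' : Fock μ D}
    (h : HasRenormalizedAction K B g ω e he Ψ Φ) (h' : HasRenormalizedAction K B g ω e he Ψ Φ') :
    Φ = Φ' := by
  obtain ⟨u, w, hu, hw, S, hS, rfl⟩ := h
  obtain ⟨u', w', hu', hw', S', hS', rfl⟩ := h'
  obtain rfl : u = u' := funext fun l => LinearPMap.mem_graph_snd_inj _ (hu l) (hu' l) rfl
  obtain rfl : w = w' := funext fun l => funext fun l' =>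
    LinearPMap.mem_graph_snd_inj _ (hw l l') (hw' l l') rfl
  rw [hS.unique hS']

theorem HasRenormalizedAction.add {Ψ Ψ' Φ Φ' : Fock μ D}
    (h : HasRenormalizedAction K B g ω e he Ψ Φ)
    (h' : HasRenormalizedAction K B g ω e he Ψ' Φ') :
    HasRenormalizedAction K B g ω e he (Ψ + Ψ') (Φ + Φ') := by
  obtain ⟨u, w, hu, hw, S, hS, rfl⟩ := h
  obtain ⟨u', w', hu', hw', S', hS', rfl⟩ := h'
  refine ⟨fun l => u l + u' l, fun l l' => w l l' + w' l l',
    fun l => Submodule.add_mem _ (hu l) (hu' l),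
    fun l l' => Submodule.add_mem _ (hw l l') (hw' l l'), S + S', ?_, ?_⟩
  · simpa only [smul_add] using hS.add hS'
  · rw [map_add]
    abel

theorem HasRenormalizedAction.smul {Ψ Φ : Fock μ D} (c : ℂ)
    (h : HasRenormalizedAction K B g ω e he Ψ Φ) :
    HasRenormalizedAction K B g ω e he (c • Ψ) (c • Φ) := by
  obtain ⟨u, w, hu, hw, S, hS, rfl⟩ := h
  refine ⟨fun l => c • u l, fun l l' => c • w l l',
    fun l => Submodule.smul_mem _ c (hu l),
    fun l l' => Submodule.smul_mem _ c (hw l l'), c • S, ?_, ?_⟩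
  · simpa only [smul_comm c] using hS.const_smul c
  · rw [map_smul, smul_add]

theorem HasRenormalizedAction.hasSum_inner {Ψ Φ Φ' : Fock μ D}
    (h : HasRenormalizedAction K B g ω e he Φ Φ') {u v : ι → Fock μ D}
    (hu : ∀ l, (Ψ, u l) ∈ (displaced B g (e l)).graph)
    (hv : ∀ l, (Φ, v l) ∈ (displaced B g (e l)).graph) :
    HasSum (fun p : ι × ι => ⟪e p.1, mulOp μ ω ⟨e p.2, he p.2⟩⟫_ℂ * ⟪u p.1, v p.2⟫_ℂ)
      ⟪Ψ, Φ' - spin μ K Φ⟫_ℂ := by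
  obtain ⟨v', w, hv', hw, S, hS, rfl⟩ := h
  obtain rfl : v' = v := funext fun l => LinearPMap.mem_graph_snd_inj _ (hv' l) (hv l) rfl
  rw [add_sub_cancel_right]
  refine (hS.mapL (innerSL ℂ Ψ)).congr_fun fun p => ?_
  have hwp := hw p.1 p.2
  rw [LinearPMap.adjoint_graph_eq_graph_adjoint (dense_numberHalfDomain μ D),
    Submodule.mem_adjoint_iff] at hwp
  rw [map_smul, innerSL_apply_apply, smul_eq_mul, ← sub_eq_zero.1 (hwp _ _ (hu p.1))]

end

variable (e : HilbertBasis ι ℂ (Lp ℂ 2 μ)) (he : ∀ l, e l ∈ (mulOp μ ω).domain)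

theorem exists_hasRenormalizedAction (K : Matrix (Fin D) (Fin D) ℂ)
    (hB : ∀ j j', Commute (B j) (B j')) {Ψ : Fock μ D} (hΨ : Ψ ∈ testDomain B g e) :
    ∃ Φ, HasRenormalizedAction K B g ω e he Ψ Φ := by
  obtain ⟨u, hu, hfin⟩ := exists_displaced_graph e.orthonormal hB hΨ
  have hw (l l' : ι) := mem_graph_adjoint_displaced B g (e l) (u l')
  have hseries (l' : ι) : HasSum
      (fun l => ⟪e l, mulOp μ ω ⟨e l', he l'⟩⟫_ℂ • displacedAdjoint B g (u l') (e l))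
      (displacedAdjoint B g (u l') (mulOp μ ω ⟨e l', he l'⟩)) := by
    simpa only [map_smul, e.repr_apply_apply] using
      (e.hasSum_repr (mulOp μ ω ⟨e l', he l'⟩)).mapL (displacedAdjoint B g (u l'))
  have hzero (l l' : ι) (hl' : l' ∉ hfin.toFinset) : displacedAdjoint B g (u l') (e l) = 0 := by
    rw [hfin.mem_toFinset, Function.notMem_support] at hl'
    exact LinearPMap.graph_fst_eq_zero_snd _ (hw l l') (congrArg Subtype.val hl')
  exact ⟨_, fun l => u l, fun l l' => displacedAdjoint B g (u l') (e l), hu, hw, _,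
    hasSum_prod_of_finite_right (fun l l' hl' => smul_eq_zero_of_right _ (hzero l l' hl'))
      fun l' _ => hseries l', rfl⟩

/-- The renormalized operator `H` on the span of the dressed test vectors. -/
def renormalized (K : Matrix (Fin D) (Fin D) ℂ) (hB : ∀ j j', Commute (B j) (B j')) :
    Fock μ D →ₗ.[ℂ] Fock μ D where
  domain := testDomain B g e
  toFun :=
    { toFun := fun Ψ => (exists_hasRenormalizedAction e he K hB Ψ.2).choose
      map_add' := fun Ψ Φ => (exists_hasRenormalizedAction e he K hB (Ψ + Φ).2).choose_spec.unique
        ((exists_hasRenormalizedAction e he K hB Ψ.2).choose_spec.add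
          (exists_hasRenormalizedAction e he K hB Φ.2).choose_spec)
      map_smul' := fun c Ψ =>
        (exists_hasRenormalizedAction e he K hB (c • Ψ).2).choose_spec.unique
          ((exists_hasRenormalizedAction e he K hB Ψ.2).choose_spec.smul c) }

theorem hasRenormalizedAction_renormalized (K : Matrix (Fin D) (Fin D) ℂ)
    (hB : ∀ j j', Commute (B j) (B j')) (Ψ : (renormalized (g := g) e he K hB).domain) :
    HasRenormalizedAction K B g ω e he Ψ (renormalized e he K hB Ψ) :=
  (exists_hasRenormalizedAction e he K hB Ψ.2).choose_spec

theorem renormalized_isFormalAdjoint (hK : K.IsHermitian)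
    (hB : ∀ j j', Commute (B j) (B j')) :
    (renormalized (g := g) e he K hB).IsFormalAdjoint (renormalized (g := g) e he K hB) := by
  intro Ψ Φ
  obtain ⟨u, hu, -⟩ := exists_displaced_graph e.orthonormal hB Ψ.2
  obtain ⟨v, hv, -⟩ := exists_displaced_graph e.orthonormal hB Φ.2
  have hΨΦ := (hasRenormalizedAction_renormalized e he K hB Φ).hasSum_inner hu hv
  have hΦΨ := (Equiv.prodComm ι ι).hasSum_iff.2 (Complex.hasSum_conj'.2
    ((hasRenormalizedAction_renormalized e he K hB Ψ).hasSum_inner hv hu))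
  have hω (l l' : ι) : (starRingEnd ℂ) ⟪e l', mulOp μ ω ⟨e l, he l⟩⟫_ℂ =
      ⟪e l, mulOp μ ω ⟨e l', he l'⟩⟫_ℂ :=
    (inner_conj_symm _ _).trans (mulOp_isFormalAdjoint ω ⟨e l, he l⟩ ⟨e l', he l'⟩)
  have hform := hΨΦ.unique (hΦΨ.congr_fun fun p => by
    simp only [Function.comp_apply, Equiv.prodComm_apply, Prod.fst_swap, Prod.snd_swap, map_mul,
      inner_conj_symm, hω])
  have hspin : ⟪spin μ K (Ψ : Fock μ D), (Φ : Fock μ D)⟫_ℂ =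
      ⟪(Ψ : Fock μ D), spin μ K (Φ : Fock μ D)⟫_ℂ := by
    rw [inner_spin_left, hK.eq]
  rw [inner_conj_symm, inner_sub_left, inner_sub_right, hspin] at hform
  exact (sub_left_injective hform).symm

theorem renormalized_isBoundedBelowBy (K : Matrix (Fin D) (Fin D) ℂ)
    (hB : ∀ j j', Commute (B j) (B j')) (hω : ∀ᵐ x ∂μ, 0 ≤ ω x) :
    IsBoundedBelowBy (renormalized (g := g) e he K hB) (-‖spin μ K‖) := by
  intro Ψ
  obtain ⟨u, hu, hfin⟩ := exists_displaced_graph e.orthonormal hB Ψ.2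
  have hform := (hasRenormalizedAction_renormalized e he K hB Ψ).hasSum_inner hu hu
  set s := hfin.toFinset with hs
  have hu0 (l : ι) (hl : l ∉ Set.range (Subtype.val : ↥s → ι)) : u l = 0 := by
    simpa only [Subtype.range_coe_subtype, Set.mem_ofPred_eq, hs, hfin.mem_toFinset,
      Function.notMem_support] using hl
  have hinj : Function.Injective (Prod.map Subtype.val Subtype.val : ↥s × ↥s → ι × ι) :=
    Subtype.val_injective.prodMap Subtype.val_injective
  have hvanish (p : ι × ι) (hp : p ∉ Set.range (Prod.map Subtype.val Subtype.val : ↥s × ↥s → _)) :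
      ⟪e p.1, mulOp μ ω ⟨e p.2, he p.2⟩⟫_ℂ * ⟪(u p.1 : Fock μ D), (u p.2 : Fock μ D)⟫_ℂ = 0 := by
    rw [Set.range_prodMap, Set.mem_prod, not_and_or] at hp
    rcases hp with hp | hp <;> simp [hu0 _ hp]
  have hsum := ((hinj.hasSum_iff hvanish).2 hform).unique (hasSum_fintype _)
  rw [Fintype.sum_prod_type] at hsum
  have hpos := re_sum_mul_inner_nonneg (posSemidef_inner_apply (mulOp_isFormalAdjoint ω)
    (mulOp_isBoundedBelowBy hω) fun l : ↥s => ⟨e l, he l⟩) fun l => (u l : Fock μ D)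
  have hK := neg_norm_mul_sq_le_re_inner (spin μ K) (Ψ : Fock μ D)
  replace hsum := congrArg Complex.re hsum
  rw [inner_sub_right, Complex.sub_re] at hsum
  exact hK.trans (sub_nonneg.1 (hsum.symm ▸ hpos))

end Hamiltonian

end GSB

end

theorem theorem2p3_general {X : Type*} [MeasurableSpace X] (μ : Measure X) [SigmaFinite μ]
    {D N : ℕ} (K : Matrix (Fin D) (Fin D) ℂ) (hK : K.IsHermitian)
    (B : Fin N → Matrix (Fin D) (Fin D) ℂ) (hB : ∀ j j', Commute (B j) (B j'))
    (ω : X → ℝ) (hω : ∀ᵐ x ∂μ, 0 ≤ ω x) (g : Fin N → Lp ℂ 2 μ)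
    {ι : Type*} (e : HilbertBasis ι ℂ (Lp ℂ 2 μ)) (he : ∀ l, e l ∈ (GSB.mulOp μ ω).domain) :
    (∀ v : EuclideanSpace ℂ (Fin D), GSB.vacuum μ v ∈ (GSB.dressing B g).domain) ∧
    (∀ (v : EuclideanSpace ℂ (Fin D)) (ls : List ι), ∃! Ψ, GSB.IsDressed B g e v ls Ψ) ∧
    Dense (GSB.testDomain B g e : Set (GSB.Fock μ D)) ∧
    ∃ H : GSB.Fock μ D →ₗ.[ℂ] GSB.Fock μ D,
      H.domain = GSB.testDomain B g e ∧
      (∀ Ψ : H.domain, GSB.HasRenormalizedAction K B g ω e he Ψ (H Ψ)) ∧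
      H.IsFormalAdjoint H ∧
      ∃ c : ℝ, GSB.IsBoundedBelowBy H c ∧
        ∃ F : GSB.Fock μ D →ₗ.[ℂ] GSB.Fock μ D,
          GSB.IsFriedrichsExtension H F ∧ H ≤ F ∧ IsSelfAdjoint F ∧
          GSB.IsBoundedBelowBy F c := by
  have hdense := GSB.dense_testDomain (D := D) e hB g
  have hsymm := GSB.renormalized_isFormalAdjoint (g := g) e he hK hB
  have hbounded := GSB.renormalized_isBoundedBelowBy (g := g) e he K hB hω
  exact ⟨GSB.vacuum_mem_dressing_domain B g, GSB.existsUnique_isDressed B g e, hdense,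
    GSB.renormalized e he K hB, rfl, GSB.hasRenormalizedAction_renormalized e he K hB, hsymm,
    _, hbounded, GSB.exists_isFriedrichsExtension hsymm hdense hbounded⟩

theorem theorem2p3 {X : Type*} [MeasurableSpace X] (μ : Measure X) [SigmaFinite μ] {D N : ℕ}
    (K : Matrix (Fin D) (Fin D) ℂ) (hK : K.IsHermitian)
    (B : Fin N → Matrix (Fin D) (Fin D) ℂ) (hB : ∀ j j', Commute (B j) (B j'))
    (ω : X → ℝ) (hω : Measurable ω) (m : ℝ) (hm : 0 < m) (hωm : ∀ᵐ x ∂μ, m ≤ ω x)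
    (f : Fin N → X → ℂ) (hf : ∀ j, Measurable (f j))
    (hfω : ∀ j, MemLp (fun x => f j x / (ω x : ℂ)) 2 μ)
    {ι : Type*} (e : HilbertBasis ι ℂ (Lp ℂ 2 μ)) (he : ∀ l, e l ∈ (GSB.mulOp μ ω).domain) :
    (∀ v : EuclideanSpace ℂ (Fin D), GSB.vacuum μ v ∈ (GSB.dressing B (GSB.ratio hfω)).domain) ∧
    (∀ (v : EuclideanSpace ℂ (Fin D)) (ls : List ι), ∃! Ψ, GSB.IsDressed B (GSB.ratio hfω) e v ls Ψ) ∧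
    Dense (GSB.testDomain B (GSB.ratio hfω) e : Set (GSB.Fock μ D)) ∧
    ∃ H : GSB.Fock μ D →ₗ.[ℂ] GSB.Fock μ D,
      H.domain = GSB.testDomain B (GSB.ratio hfω) e ∧
      (∀ Ψ : H.domain, GSB.HasRenormalizedAction K B (GSB.ratio hfω) ω e he Ψ (H Ψ)) ∧
      H.IsFormalAdjoint H ∧
      ∃ c : ℝ, GSB.IsBoundedBelowBy H c ∧
        ∃ F : GSB.Fock μ D →ₗ.[ℂ] GSB.Fock μ D,
          GSB.IsFriedrichsExtension H F ∧ H ≤ F ∧ IsSelfAdjoint F ∧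
          GSB.IsBoundedBelowBy F c :=
  theorem2p3_general μ K hK B hB ω (hωm.mono fun _ hx => hm.le.trans hx) (GSB.ratio hfω) e he
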